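/- **Theorem 2.3.** Let $d,k,e_+$ be positive integers with $0<e_+\le d$, let $e_-\in\mathbb Z$, and let $Q\in\mathbb C[t]$ be a polynomial with $Q(0)\neq 0$. Consider the $\mathbb Q$-divisors $$D_+=-\frac{e_+}{d}[0],\qquad D_-=-\frac{e_-}{d}[0]-\frac1k\operatorname{div}(Q)$$ on the affine line $\mathbb A^1=\operatorname{Spec}\mathbb C[t]$ and assume that $D_++D_-\le 0$; then $e_++e_-\ge 0$. (By the classification of normal affine $\mathbb C^*$-surfaces $\operatorname{Spec}\,\mathbb C[t][D_+,D_-]$ with a $\mathbb C_+$-action, every such surface is given by a pair of this form, after interchanging $D_+$ and $D_-$ and passing to an equivalent pair, if necessary.) Let $V=\operatorname{Spec}A$ be the corresponding normal affine $\mathbb C^*$-surface with DPD-presentation $$A=\mathbb C[t][D_+,D_-]=\bigoplus_{i\in\mathbb Z}A_i\subseteq\mathbb C(t)[u,u^{-1}],\qquad A_{\pm i}=\{f\in\mathbb C(t): f=0\ \text{or}\ \operatorname{div}f+iD_\pm\ge 0\}\,u^{\pm i}\quad(i\ge 0),$$ where $\lambda\in\mathbb C^*$ acts on $A_i$ as multiplication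 by $\lambda^i$. Then the polynomial $$F=x^ky-s^{k(e_++e_-)}\,Q(s^d/z)\,z^{\deg Q}\in\mathbb C[x,y,z,s]$$ is weighted homogeneous of degree $k(e_++e_-)+d\deg Q$ with respect to the weights $$\deg x=e_+,\quad \deg y=ke_-+d\deg Q,\quad \deg z=d,\quad \deg s=1,$$ and $V$ is $\mathbb C^*$-equivariantly isomorphic to the normalization of the principal Zariski open subset $\mathbb D_+(z)=\{z\ne0\}$ of the hypersurface $\mathbb V_+(F)=\{F=0\}$ in the weighted projective 3-space $\mathbb P(e_+,\,ke_-+d\deg Q,\,d,\,1)$, where $\mathbb C^*$ acts on $\mathbb V_+(F)$ by $\lambda.(x:y:z:s)=(\lambda x:\lambda^{-k}y:z:s)$. If the weight $ke_-+d\deg Q$ of $y$ is not positive, the statement holds with $\mathbb D_+(z)$ understood as $\operatorname{Spec}\,(R[1/z])_0$, the spectrum of the degree zero part of the $\mathbb Z$-graded ring $R[1/z]$, where $R=\mathbb C[x,y,z,s]/(F)$. -/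

import Mathlib

open AlgebraicGeometry CategoryTheory
open scoped Polynomial LaurentPolynomial

noncomputable section

namespace CStarSurface

/-! ### Orders of rational functions and the algebra of a pair of `ℚ`-divisors -/

/-- The order of vanishing of the rational function `f ∈ ℂ(t)` at the point `c` of the affine line
(with junk value `0` at `f = 0`). -/
def ord (c : ℂ) (f : RatFunc ℂ) : ℤ :=
  (f.num.rootMultiplicity c : ℤ) - f.denom.rootMultiplicity c

/-- The divisor of a nonzero polynomial on the affine line. -/
def divisor (Q : ℂ[X]) : ℂ →₀ ℚ :=
  (Multiset.toFinsupp Q.roots).mapRange (Nat.cast : ℕ → ℚ) Nat.cast_zero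

theorem ord_mul {f g : RatFunc ℂ} (hf : f ≠ 0) (hg : g ≠ 0) (c : ℂ) :
    ord c (f * g) = ord c f + ord c g := by
  have h := RatFunc.num_denom_mul f g
  have hfg : f * g ≠ 0 := mul_ne_zero hf hg
  have nf := RatFunc.num_ne_zero hf
  have ng := RatFunc.num_ne_zero hg
  have nfg := RatFunc.num_ne_zero hfg
  have df := RatFunc.denom_ne_zero f
  have dg := RatFunc.denom_ne_zero g
  have dfg := RatFunc.denom_ne_zero (f * g)
  have h' := congrArg (Polynomial.rootMultiplicity c) h
  rw [Polynomial.rootMultiplicity_mul (by simp [*]), Polynomial.rootMultiplicity_mul (by simp [*]),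
    Polynomial.rootMultiplicity_mul (by simp [*]),
    Polynomial.rootMultiplicity_mul (by simp [*])] at h'
  unfold ord
  omega

theorem min_le_ord_add {f g : RatFunc ℂ} (hf : f ≠ 0) (hg : g ≠ 0) (hfg : f + g ≠ 0) (c : ℂ) :
    min (ord c f) (ord c g) ≤ ord c (f + g) := by
  have h := RatFunc.num_denom_add f g
  have nf := RatFunc.num_ne_zero hf
  have ng := RatFunc.num_ne_zero hg
  have nfg := RatFunc.num_ne_zero hfg
  have df := RatFunc.denom_ne_zero f
  have dg := RatFunc.denom_ne_zero g
  have dfg := RatFunc.denom_ne_zero (f + g)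
  have hs : f.num * g.denom + f.denom * g.num ≠ 0 := by
    intro h0
    rw [h0, zero_mul] at h
    simp [*] at h
  have h' := congrArg (Polynomial.rootMultiplicity c) h
  have h2 := Polynomial.rootMultiplicity_add (p := f.num * g.denom) (q := f.denom * g.num) c hs
  rw [Polynomial.rootMultiplicity_mul (by simp [*]), Polynomial.rootMultiplicity_mul (by simp [*]),
    Polynomial.rootMultiplicity_mul (by simp [*])] at h'
  rw [Polynomial.rootMultiplicity_mul (by simp [*]),
    Polynomial.rootMultiplicity_mul (by simp [*])] at h2
  unfold ord
  omega

/-- A pair of `ℚ`-divisors on the affine line `Spec ℂ[t]` with `D₊ + D₋ ≤ 0`. -/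
structure DivisorPair where
  plus : ℂ →₀ ℚ
  minus : ℂ →₀ ℚ
  nonpos : ∀ c, plus c + minus c ≤ 0

namespace DivisorPair

variable (D : DivisorPair)

/-- The value at `c` of the divisor `i D₊` for `i ≥ 0` and of `(-i) D₋` for `i < 0`. -/
def bound (i : ℤ) (c : ℂ) : ℚ :=
  if 0 ≤ i then i * D.plus c else -i * D.minus c

theorem bound_add_le (i j : ℤ) (c : ℂ) : D.bound i c + D.bound j c ≤ D.bound (i + j) c := by
  have h := D.nonpos c
  unfold bound
  split_ifs with h1 h2 h3 h3 h2 h3 h3 <;> push_cast <;> try omega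
  all_goals
    have hi : (0 : ℚ) ≤ i ∨ (i : ℚ) ≤ 0 := le_total _ _
    try rw [not_le] at h1
    try rw [not_le] at h2
    try rw [not_le] at h3
    qify at *
    nlinarith

/-- `f` belongs to `{f ∈ ℂ(t) ∣ div f + i D₊ ≥ 0}` for `i ≥ 0`, respectively to
`{f ∈ ℂ(t) ∣ div f + (-i) D₋ ≥ 0}` for `i < 0`; zero belongs to it by convention. -/
def Allowed (i : ℤ) (f : RatFunc ℂ) : Prop :=
  f ≠ 0 → ∀ c, 0 ≤ (ord c f : ℚ) + D.bound i c

variable {D}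

theorem Allowed.add {i : ℤ} {f g : RatFunc ℂ} (hf : D.Allowed i f) (hg : D.Allowed i g) :
    D.Allowed i (f + g) := by
  intro h c
  by_cases f0 : f = 0
  · subst f0; simpa using hg (by simpa using h) c
  by_cases g0 : g = 0
  · subst g0; simpa using hf (by simpa using h) c
  have h1 := hf f0 c
  have h2 := hg g0 c
  have h3 := min_le_ord_add f0 g0 h c
  rcases min_le_iff.1 h3 with h4 | h4
  · have : (ord c f : ℚ) ≤ ord c (f + g) := by exact_mod_cast h4
    linarith
  · have : (ord c g : ℚ) ≤ ord c (f + g) := by exact_mod_cast h4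
    linarith

theorem Allowed.mul {i j : ℤ} {f g : RatFunc ℂ} (hf : D.Allowed i f) (hg : D.Allowed j g) :
    D.Allowed (i + j) (f * g) := by
  intro h c
  have f0 := left_ne_zero_of_mul h
  have g0 := right_ne_zero_of_mul h
  have h1 := hf f0 c
  have h2 := hg g0 c
  have h3 := D.bound_add_le i j c
  rw [ord_mul f0 g0]
  push_cast
  linarith

theorem Allowed.zero (i : ℤ) : D.Allowed i 0 := fun h => absurd rfl h

theorem Allowed.const (a : ℂ) : D.Allowed 0 (algebraMap ℂ (RatFunc ℂ) a) := by
  intro _ c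
  simp [ord, bound]

variable (D)

/-- The graded algebra `A = ℂ[t][D₊, D₋] ⊆ ℂ(t)[u, u⁻¹]` of the pair `(D₊, D₋)`; the
indeterminate `T` of the Laurent polynomials is `u`. -/
def algebra : Subalgebra ℂ (RatFunc ℂ)[T;T⁻¹] where
  carrier := {p | ∀ i, D.Allowed i (p.coeff i)}
  mul_mem' := by
    intro p q hp hq n
    have h0 : ∀ f g : RatFunc ℂ, D.Allowed n f → D.Allowed n g → D.Allowed n (f + g) :=
      fun _ _ => Allowed.add
    rw [AddMonoidAlgebra.coeff_mul]
    refine Finset.sum_induction _ (D.Allowed n) h0 (Allowed.zero n) fun i _ => ?_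
    refine Finset.sum_induction _ (D.Allowed n) h0 (Allowed.zero n) fun j _ => ?_
    dsimp only
    split_ifs with h
    · rw [← h]; exact (hp i).mul (hq j)
    · exact Allowed.zero n
  add_mem' := by
    intro p q hp hq i
    exact (hp i).add (hq i)
  algebraMap_mem' := by
    intro a i
    rw [LaurentPolynomial.algebraMap_apply, LaurentPolynomial.C_apply]
    split_ifs with h
    · subst h; exact Allowed.const a
    · exact Allowed.zero i

/-- The automorphism `∑ fᵢ uⁱ ↦ ∑ aⁱ fᵢ uⁱ` of `ℂ(t)[u, u⁻¹]`. -/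
def laurentScale (a : ℂˣ) : (RatFunc ℂ)[T;T⁻¹] →+* (RatFunc ℂ)[T;T⁻¹] :=
  (AddMonoidAlgebra.lift (RatFunc ℂ) (RatFunc ℂ)[T;T⁻¹] ℤ
    { toFun := fun n => LaurentPolynomial.C (algebraMap ℂ (RatFunc ℂ) ((a ^ n.toAdd : ℂˣ) : ℂ)) *
        LaurentPolynomial.T n.toAdd
      map_one' := by simp
      map_mul' := fun m n => by
        simp only [toAdd_mul, zpow_add, Units.val_mul, map_mul, LaurentPolynomial.T_add]
        ring }).toRingHom

theorem coeff_laurentScale (a : ℂˣ) (p : (RatFunc ℂ)[T;T⁻¹]) (i : ℤ) :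
    (laurentScale a p).coeff i = algebraMap ℂ (RatFunc ℂ) ((a ^ i : ℂˣ) : ℂ) * p.coeff i := by
  induction p using LaurentPolynomial.induction_on' with
  | add p q hp hq => simp [hp, hq, mul_add]
  | C_mul_T n f =>
    rw [← LaurentPolynomial.single_eq_C_mul_T]
    simp only [laurentScale, AlgHom.toRingHom_eq_coe, RingHom.coe_coe,
      AddMonoidAlgebra.lift_single, MonoidHom.coe_mk, OneHom.coe_mk, toAdd_ofAdd,
      ← LaurentPolynomial.single_eq_C_mul_T]
    simp only [AddMonoidAlgebra.coeff_smul, AddMonoidAlgebra.coeff_single, Finsupp.smul_apply,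
      Finsupp.single_apply, smul_eq_mul]
    split_ifs with h
    · subst h; ring
    · simp

/-- The action of `a ∈ ℂ^*` on `A = ⨁ Aᵢ`, that is, multiplication by `aⁱ` on `Aᵢ`. -/
def act (a : ℂˣ) : D.algebra →+* D.algebra :=
  (laurentScale a).restrict D.algebra D.algebra (by
    intro p hp i
    rw [coeff_laurentScale]
    simpa using (Allowed.const (D := D) ((a ^ i : ℂˣ) : ℂ)).mul (hp i))

theorem act_one : D.act 1 = RingHom.id _ := by
  refine RingHom.ext fun p => Subtype.ext (LaurentPolynomial.ext fun i => ?_)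
  change (laurentScale 1 p.1).coeff i = _
  simp [coeff_laurentScale]

theorem act_mul (a b : ℂˣ) : D.act (a * b) = (D.act a).comp (D.act b) := by
  refine RingHom.ext fun p => Subtype.ext (LaurentPolynomial.ext fun i => ?_)
  change (laurentScale (a * b) p.1).coeff i = (laurentScale a (laurentScale b p.1)).coeff i
  simp only [coeff_laurentScale, mul_zpow, Units.val_mul, map_mul, mul_assoc]

theorem act_algebraMap (a : ℂˣ) (c : ℂ) :
    D.act a (algebraMap ℂ D.algebra c) = algebraMap ℂ D.algebra c := by
  refine Subtype.ext (LaurentPolynomial.ext fun i => ?_)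
  change (laurentScale a (algebraMap ℂ (RatFunc ℂ)[T;T⁻¹] c)).coeff i =
    (algebraMap ℂ (RatFunc ℂ)[T;T⁻¹] c).coeff i
  rw [coeff_laurentScale, LaurentPolynomial.algebraMap_apply, LaurentPolynomial.C_apply]
  split_ifs with h
  · simp [h]
  · simp

end DivisorPair

/-! ### Gradings of `ℂ[x, y, z, s]` and of its quotients

The variables `x, y, z, s` are `X 0, X 1, X 2, X 3`. -/

section Grading

variable {M : Type} [AddCommMonoid M] [DecidableEq M]

attribute [local instance] MvPolynomial.weightedGradedAlgebra

/-- The ring `ℂ[x, y, z, s] / (F)`. -/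
abbrev QuotRing (F : MvPolynomial (Fin 4) ℂ) : Type := MvPolynomial (Fin 4) ℂ ⧸ Ideal.span {F}

/-- The grading of `ℂ[x, y, z, s] / (F)` induced by the weights `w` of the variables. -/
def quotGrading (w : Fin 4 → M) (F : MvPolynomial (Fin 4) ℂ) (m : M) :
    Submodule ℂ (QuotRing F) :=
  (MvPolynomial.weightedHomogeneousSubmodule ℂ w m).map
    (Ideal.Quotient.mkₐ ℂ (Ideal.span {F})).toLinearMap

theorem span_isHomogeneous {w : Fin 4 → M} {F : MvPolynomial (Fin 4) ℂ} {n : M}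
    (hF : F.IsWeightedHomogeneous w n) :
    (Ideal.span {F}).IsHomogeneous (MvPolynomial.weightedHomogeneousSubmodule ℂ w) :=
  Ideal.homogeneous_span _ _ (by rintro _ rfl; exact ⟨n, hF⟩)

/-- The linear map `ℂ[x, y, z, s] → ⨁ₘ (ℂ[x, y, z, s] / (F))ₘ` taking homogeneous components. -/
def quotDecomposeAux (w : Fin 4 → M) (F : MvPolynomial (Fin 4) ℂ) :
    MvPolynomial (Fin 4) ℂ →ₗ[ℂ] DirectSum M fun m => quotGrading w F m :=
  (DirectSum.lmap fun m => ((Ideal.Quotient.mkₐ ℂ (Ideal.span {F})).toLinearMap.submoduleMap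
    (MvPolynomial.weightedHomogeneousSubmodule ℂ w m))) ∘ₗ
  (DirectSum.decomposeLinearEquiv (MvPolynomial.weightedHomogeneousSubmodule ℂ w)).toLinearMap

theorem quotDecomposeAux_coe (w : Fin 4 → M) (F p : MvPolynomial (Fin 4) ℂ) (m : M) :
    (quotDecomposeAux w F p m : QuotRing F) = Ideal.Quotient.mk _
      (DirectSum.decompose (MvPolynomial.weightedHomogeneousSubmodule ℂ w) p m :
        MvPolynomial (Fin 4) ℂ) := by
  rfl

theorem quotDecomposeAux_eq_zero {w : Fin 4 → M} {F : MvPolynomial (Fin 4) ℂ} {n : M}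
    (hF : F.IsWeightedHomogeneous w n) (p : MvPolynomial (Fin 4) ℂ) (hp : p ∈ Ideal.span {F}) :
    quotDecomposeAux w F p = 0 := by
  refine DFinsupp.ext fun m => Subtype.ext ?_
  rw [quotDecomposeAux_coe]
  exact Ideal.Quotient.eq_zero_iff_mem.2 (span_isHomogeneous hF m hp)

theorem quotDecomposeAux_congr {w : Fin 4 → M} {F : MvPolynomial (Fin 4) ℂ} {n : M}
    (hF : F.IsWeightedHomogeneous w n) (p q : MvPolynomial (Fin 4) ℂ)
    (h : Ideal.Quotient.mk (Ideal.span {F}) p = Ideal.Quotient.mk (Ideal.span {F}) q) :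
    quotDecomposeAux w F p = quotDecomposeAux w F q := by
  have h1 := quotDecomposeAux_eq_zero hF (p - q) (Ideal.Quotient.eq.1 h)
  have h2 := (quotDecomposeAux w F).map_add (p - q) q
  rwa [h1, zero_add, sub_add_cancel] at h2

/-- Taking homogeneous components in `ℂ[x, y, z, s] / (F)`. -/
def quotDecompose (w : Fin 4 → M) (F : MvPolynomial (Fin 4) ℂ) (n : M)
    (hF : F.IsWeightedHomogeneous w n) :
    QuotRing F →ₗ[ℂ] DirectSum M fun m => quotGrading w F m where
  toFun q := quotDecomposeAux w F q.out
  map_add' q r := by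
    rw [← map_add]
    exact quotDecomposeAux_congr hF _ _ (by simp)
  map_smul' a q := by
    rw [RingHom.id_apply, ← map_smul]
    refine quotDecomposeAux_congr hF _ _ ?_
    change _ = Ideal.Quotient.mkₐ ℂ _ _
    rw [map_smul]
    simp

theorem quotDecompose_mk (w : Fin 4 → M) (F : MvPolynomial (Fin 4) ℂ) (n : M)
    (hF : F.IsWeightedHomogeneous w n) (p : MvPolynomial (Fin 4) ℂ) :
    quotDecompose w F n hF (Ideal.Quotient.mk _ p) = quotDecomposeAux w F p :=
  quotDecomposeAux_congr hF _ _ (by simp)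

/-- If `F` is weighted homogeneous, then `ℂ[x, y, z, s] / (F)` is a graded algebra. -/
@[reducible]
def quotGradedAlgebra (w : Fin 4 → M) (F : MvPolynomial (Fin 4) ℂ) (n : M)
    (hF : F.IsWeightedHomogeneous w n) : GradedAlgebra (quotGrading w F) where
  one_mem := ⟨1, SetLike.GradedOne.one_mem, map_one (Ideal.Quotient.mk _)⟩
  mul_mem := by
    rintro i j _ _ ⟨p, hp, rfl⟩ ⟨q, hq, rfl⟩
    exact ⟨p * q, SetLike.GradedMul.mul_mem hp hq, map_mul (Ideal.Quotient.mk _) _ _⟩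
  toDecomposition := DirectSum.Decomposition.ofLinearMap _ (quotDecompose w F n hF)
    (by
      apply LinearMap.ext
      intro q
      obtain ⟨p, rfl⟩ := Ideal.Quotient.mk_surjective q
      have key : (DirectSum.coeLinearMap (quotGrading w F)) ∘ₗ quotDecomposeAux w F =
          (Ideal.Quotient.mkₐ ℂ (Ideal.span {F})).toLinearMap := by
        rw [quotDecomposeAux, ← LinearMap.comp_assoc, ← LinearEquiv.eq_comp_toLinearMap_symm]
        apply DirectSum.linearMap_ext
        intro m
        apply LinearMap.ext
        intro x
        simp only [LinearMap.comp_apply, LinearEquiv.coe_coe]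
        erw [DirectSum.lmap_lof, DirectSum.coeLinearMap_lof, DirectSum.decomposeLinearEquiv_symm_lof]
        rfl
      rw [LinearMap.comp_apply, quotDecompose_mk]
      exact LinearMap.congr_fun key p)
    (by
      apply DirectSum.linearMap_ext
      intro m
      apply LinearMap.ext
      rintro ⟨_, p, hp, rfl⟩
      simp only [LinearMap.comp_apply, DirectSum.coeLinearMap_lof, LinearMap.id_apply]
      have hd : DirectSum.decompose (MvPolynomial.weightedHomogeneousSubmodule ℂ w) p =
          DirectSum.lof ℂ M (fun i => MvPolynomial.weightedHomogeneousSubmodule ℂ w i) m ⟨p, hp⟩ :=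
        DirectSum.decompose_of_mem _ hp
      refine (quotDecompose_mk w F n hF p).trans ?_
      simp only [quotDecomposeAux, LinearMap.comp_apply, LinearEquiv.coe_coe,
        DirectSum.decomposeLinearEquiv_apply]
      rw [hd]
      exact DirectSum.lmap_lof _ _ _)

/-- The substitution `x ↦ c₀ x, y ↦ c₁ y, z ↦ c₂ z, s ↦ c₃ s`. -/
def polyScale (c : Fin 4 → ℂ) : MvPolynomial (Fin 4) ℂ →ₐ[ℂ] MvPolynomial (Fin 4) ℂ :=
  MvPolynomial.aeval fun i => MvPolynomial.C (c i) * MvPolynomial.X i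

theorem polyScale_monomial (c : Fin 4 → ℂ) (m : Fin 4 →₀ ℕ) (a : ℂ) :
    polyScale c (MvPolynomial.monomial m a) =
      MvPolynomial.monomial m (a * m.prod fun i e => c i ^ e) := by
  rw [polyScale, MvPolynomial.aeval_monomial, MvPolynomial.monomial_eq]
  simp only [mul_pow, map_mul, Finsupp.prod, map_prod, map_pow,
    MvPolynomial.algebraMap_eq, Finset.prod_mul_distrib]
  ring

theorem polyScale_mem {M : Type} [AddCommMonoid M] {w : Fin 4 → M} (c : Fin 4 → ℂ) {m : M} {p : MvPolynomial (Fin 4) ℂ}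
    (hp : p ∈ MvPolynomial.weightedHomogeneousSubmodule ℂ w m) :
    polyScale c p ∈ MvPolynomial.weightedHomogeneousSubmodule ℂ w m := by
  rw [p.as_sum, map_sum]
  refine Submodule.sum_mem _ fun e he => ?_
  rw [polyScale_monomial]
  exact MvPolynomial.isWeightedHomogeneous_monomial w e _ (hp (MvPolynomial.mem_support_iff.1 he))

/-- The endomorphism of `ℂ[x, y, z, s] / (F)` induced by the rescaling `c` of the variables, if the
latter fixes `F`. -/
def quotScale (F : MvPolynomial (Fin 4) ℂ) (c : Fin 4 → ℂ) (hc : polyScale c F = F) :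
    QuotRing F →ₐ[ℂ] QuotRing F :=
  Ideal.quotientMapₐ _ (polyScale c) (by
    rw [Ideal.span_le, Set.singleton_subset_iff]
    change polyScale c F ∈ Ideal.span {F}
    rw [hc]
    exact Ideal.mem_span_singleton_self F)

theorem quotScale_mk (F : MvPolynomial (Fin 4) ℂ) (c : Fin 4 → ℂ) (hc : polyScale c F = F)
    (p : MvPolynomial (Fin 4) ℂ) :
    quotScale F c hc (Ideal.Quotient.mk _ p) = Ideal.Quotient.mk _ (polyScale c p) := rfl

/-- The same endomorphism as a homomorphism of graded rings. -/
def gradedScale (w : Fin 4 → M) (F : MvPolynomial (Fin 4) ℂ) (c : Fin 4 → ℂ)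
    (hc : polyScale c F = F) : quotGrading w F →+*ᵍ quotGrading w F where
  toRingHom := (quotScale F c hc).toRingHom
  map_mem := by
    rintro m _ ⟨p, hp, rfl⟩
    exact ⟨polyScale c p, polyScale_mem c hp, rfl⟩

theorem polyScale_mul (c c' : Fin 4 → ℂ) (p : MvPolynomial (Fin 4) ℂ) :
    polyScale c (polyScale c' p) = polyScale (c * c') p := by
  have : (polyScale c).comp (polyScale c') = polyScale (c * c') := by
    refine MvPolynomial.algHom_ext fun i => ?_
    simp only [polyScale, AlgHom.comp_apply, MvPolynomial.aeval_X, map_mul, Pi.mul_apply,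
      MvPolynomial.algHom_C, MvPolynomial.algebraMap_eq]
    ring
  exact DFunLike.congr_fun this p

theorem polyScale_one (p : MvPolynomial (Fin 4) ℂ) : polyScale 1 p = p := by
  simp [polyScale]

/-- The quotient map as a homomorphism of graded rings. -/
def gradedMk (w : Fin 4 → M) (F : MvPolynomial (Fin 4) ℂ) :
    MvPolynomial.weightedHomogeneousSubmodule ℂ w →+*ᵍ quotGrading w F where
  toRingHom := Ideal.Quotient.mk _
  map_mem := fun {_ p} hp => ⟨p, hp, rfl⟩

end Grading

/-! ### Functoriality of degree zero localizations and of `Proj` -/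

section Generic

variable {A : Type} [CommRing A] [Algebra ℂ A]

theorem localizationMap_of_eq_id {M : Type} [AddCommMonoid M] [DecidableEq M]
    {𝒜 : M → Submodule ℂ A} [GradedAlgebra 𝒜] (S : Submonoid A) (f : 𝒜 →+*ᵍ 𝒜)
    (hf : S ≤ S.comap f) (h : f = GradedRingHom.id 𝒜) :
    HomogeneousLocalization.map f hf = RingHom.id (HomogeneousLocalization 𝒜 S) := by
  subst h
  refine RingHom.ext fun q => ?_
  obtain ⟨q, rfl⟩ := HomogeneousLocalization.mk_surjective q
  rfl

theorem localizationMap_of_eq_comp {M : Type} [AddCommMonoid M] [DecidableEq M]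
    {𝒜 : M → Submodule ℂ A} [GradedAlgebra 𝒜] (S : Submonoid A) (f g k : 𝒜 →+*ᵍ 𝒜)
    (hf : S ≤ S.comap f) (hg : S ≤ S.comap g) (hk : S ≤ S.comap k) (h : k = f.comp g) :
    (HomogeneousLocalization.map k hk : HomogeneousLocalization 𝒜 S →+* _) =
      (HomogeneousLocalization.map f hf).comp (HomogeneousLocalization.map g hg) := by
  subst h
  refine RingHom.ext fun q => ?_
  obtain ⟨q, rfl⟩ := HomogeneousLocalization.mk_surjective q
  rfl

theorem localizationMap_comp_str {M : Type} [AddCommMonoid M] [DecidableEq M]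
    {𝒜 : M → Submodule ℂ A} [GradedAlgebra 𝒜] (S T : Submonoid A) (f : 𝒜 →+*ᵍ 𝒜)
    (hf : S ≤ T.comap f) (h : ∀ c : ℂ, f (algebraMap ℂ A c) = algebraMap ℂ A c) :
    (HomogeneousLocalization.map f hf).comp
        ((HomogeneousLocalization.fromZeroRingHom 𝒜 S).comp (algebraMap ℂ (𝒜 0))) =
      (HomogeneousLocalization.fromZeroRingHom 𝒜 T).comp (algebraMap ℂ (𝒜 0)) := by
  refine RingHom.ext fun c => ?_
  apply HomogeneousLocalization.val_injective
  have h1 : ((algebraMap ℂ (𝒜 0) c : 𝒜 0) : A) = algebraMap ℂ A c := rfl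
  change Localization.mk (f (algebraMap ℂ (𝒜 0) c : 𝒜 0)) ⟨f 1, _⟩ =
    Localization.mk ((algebraMap ℂ (𝒜 0) c : 𝒜 0) : A) 1
  rw [h1, h]
  congr 1
  exact Subtype.ext (map_one f)

variable {𝒜 : ℕ → Submodule ℂ A} [GradedAlgebra 𝒜]

theorem projMap_of_eq_id (f : 𝒜 →+*ᵍ 𝒜) (hf) (h : f = GradedRingHom.id 𝒜) :
    Proj.map f hf = 𝟙 (Proj 𝒜) := by
  subst h
  exact Proj.map_id

theorem projMap_of_eq_comp (f g k : 𝒜 →+*ᵍ 𝒜) (hf hg hk) (h : k = g.comp f) :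
    Proj.map k hk = Proj.map g hg ≫ Proj.map f hf := by
  subst h
  exact Proj.map_comp f g hf hg

theorem projMap_str_aux (f : 𝒜 →+*ᵍ 𝒜) (hf)
    (h : ∀ c : ℂ, f (algebraMap ℂ A c) = algebraMap ℂ A c) {i : ℕ} (hi : 0 < i) (t : A)
    (ht : t ∈ 𝒜 i) :
    Proj.awayι 𝒜 (f t) (f.2 ht) hi ≫ Proj.map f hf ≫ Proj.toSpecZero 𝒜 ≫
        Spec.map (CommRingCat.ofHom (algebraMap ℂ (𝒜 0))) =
      Proj.awayι 𝒜 (f t) (f.2 ht) hi ≫ Proj.toSpecZero 𝒜 ≫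
        Spec.map (CommRingCat.ofHom (algebraMap ℂ (𝒜 0))) := by
  rw [Proj.awayι_comp_map_assoc f hf hi t ht, Proj.awayι_toSpecZero_assoc,
    Proj.awayι_toSpecZero_assoc, ← Spec.map_comp, ← Spec.map_comp, ← Spec.map_comp,
    ← CommRingCat.ofHom_comp, ← CommRingCat.ofHom_comp, ← CommRingCat.ofHom_comp]
  exact congrArg (fun r => Spec.map (CommRingCat.ofHom r)) (localizationMap_comp_str _ _ f _ h)

theorem projMap_str (f : 𝒜 →+*ᵍ 𝒜) (hf)
    (h : ∀ c : ℂ, f (algebraMap ℂ A c) = algebraMap ℂ A c) :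
    Proj.map f hf ≫ Proj.toSpecZero 𝒜 ≫ Spec.map (CommRingCat.ofHom (algebraMap ℂ (𝒜 0))) =
      Proj.toSpecZero 𝒜 ≫ Spec.map (CommRingCat.ofHom (algebraMap ℂ (𝒜 0))) :=
  (Proj.mapAffineOpenCover f hf).openCover.hom_ext _ _ fun s =>
    projMap_str_aux f hf h s.1.2 _ s.2.2

end Generic

/-! ### Normalizations -/

/-- The morphism `ν : V ⟶ X` exhibits `V` as the normalization of the integral scheme `X`:
`V` is integral and normal, and `ν` is integral and birational. -/
structure IsNormalization {V X : Scheme.{0}} (ν : V ⟶ X) : Prop where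
  isIntegral_source : IsIntegral V
  isIntegral_target : IsIntegral X
  normal : ∀ v : V, IsIntegrallyClosed (V.presheaf.stalk v)
  isIntegralHom : IsIntegralHom ν
  birational : ∃ U : X.Opens, (U : Set X).Nonempty ∧ IsIso (ν ∣_ U)

/-- A complex scheme with an action of the group `ℂ^*` by automorphisms over `ℂ`. -/
structure ActedScheme where
  toScheme : Scheme.{0}
  str : toScheme ⟶ Spec (CommRingCat.of ℂ)
  act : ℂˣ → (toScheme ⟶ toScheme)
  act_one : act 1 = 𝟙 toScheme
  act_mul : ∀ a b, act (a * b) = act a ≫ act b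
  act_str : ∀ a, act a ≫ str = str

/-- The spectrum of a complex algebra with an action of `ℂ^*`. -/
def ActedScheme.ofRing (R : Type) [CommRing R] (str : ℂ →+* R) (act : ℂˣ → R →+* R)
    (act_one : act 1 = RingHom.id R) (act_mul : ∀ a b, act (a * b) = (act a).comp (act b))
    (act_str : ∀ a, (act a).comp str = str) : ActedScheme where
  toScheme := Spec (CommRingCat.of R)
  str := Spec.map (CommRingCat.ofHom str)
  act a := Spec.map (CommRingCat.ofHom (act a))
  act_one := by rw [act_one]; exact Spec.map_id _
  act_mul a b := by
    rw [act_mul, CommRingCat.ofHom_comp, Spec.map_comp]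
  act_str a := by
    rw [← Spec.map_comp, ← CommRingCat.ofHom_comp, act_str]

/-- `V` is equivariantly isomorphic, over `ℂ`, to the normalization of `X`. As an action on an
integral scheme lifts in a unique way to its normalization, this means that there is an
equivariant morphism `V ⟶ X` over `ℂ` that exhibits `V` as the normalization of `X`. -/
def IsEquivariantNormalization (V X : ActedScheme) : Prop :=
  ∃ ν : V.toScheme ⟶ X.toScheme, IsNormalization ν ∧ ν ≫ X.str = V.str ∧
    ∀ a : ℂˣ, V.act a ≫ ν = ν ≫ X.act a

/-! ### The surface and the hypersurface -/

/-- A pair of divisors `D₊ = -(e₊/d)[0]` with `0 < e₊ ≤ d` and `D₋ = -(e₋/d)[0] - (1/k) div Q`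
with `Q(0) ≠ 0`, such that `D₊ + D₋ ≤ 0`. -/
structure Presentation extends DivisorPair where
  d : ℕ
  k : ℕ
  ePlus : ℕ
  eMinus : ℤ
  Q : ℂ[X]
  ePlus_pos : 0 < ePlus
  ePlus_le : ePlus ≤ d
  k_pos : 0 < k
  eval_Q : Q.eval 0 ≠ 0
  plus_eq : plus = Finsupp.single 0 (-((ePlus : ℚ) / d))
  minus_eq : minus = Finsupp.single 0 (-((eMinus : ℚ) / d)) - (1 / k : ℚ) • divisor Q

namespace Presentation

open MvPolynomial (X C)

variable (P : Presentation)

theorem d_pos : 0 < P.d := P.ePlus_pos.trans_le P.ePlus_le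

theorem eSum_nonneg : 0 ≤ (P.ePlus : ℤ) + P.eMinus := by
  have h := P.nonpos 0
  have hr : P.Q.rootMultiplicity 0 = 0 := Polynomial.rootMultiplicity_eq_zero P.eval_Q
  have hd : (0 : ℚ) < P.d := by exact_mod_cast P.d_pos
  rw [P.plus_eq, P.minus_eq] at h
  simp [divisor, hr] at h
  have h2 : (0 : ℚ) ≤ (P.ePlus + P.eMinus) / P.d := by rw [add_div]; linarith
  have h3 : (0 : ℚ) ≤ P.ePlus + P.eMinus := by
    have := mul_nonneg h2 hd.le
    rwa [div_mul_cancel₀ _ hd.ne'] at this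
  exact_mod_cast h3

/-- The exponent `k(e₊ + e₋)`, which is nonnegative by `eSum_nonneg`. -/
def exponent : ℕ := (P.k * (P.ePlus + P.eMinus)).toNat

theorem exponent_cast : (P.exponent : ℤ) = P.k * (P.ePlus + P.eMinus) :=
  Int.toNat_of_nonneg (mul_nonneg (Int.natCast_nonneg _) P.eSum_nonneg)

/-- The polynomial `Q(s^d/z) z^{deg Q}`. -/
def homQ : MvPolynomial (Fin 4) ℂ :=
  ∑ j ∈ Finset.range (P.Q.natDegree + 1),
    C (P.Q.coeff j) * X 3 ^ (P.d * j) * X 2 ^ (P.Q.natDegree - j)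

/-- The polynomial `F = x^k y - s^{k(e₊ + e₋)} Q(s^d/z) z^{deg Q}`. -/
def F : MvPolynomial (Fin 4) ℂ := X 0 ^ P.k * X 1 - X 3 ^ P.exponent * P.homQ

/-- The weight `k e₋ + d deg Q` of `y`. -/
def weightY : ℤ := P.k * P.eMinus + P.d * P.Q.natDegree

/-- The weights `e₊, k e₋ + d deg Q, d, 1` of `x, y, z, s`. -/
def weight : Fin 4 → ℤ := ![P.ePlus, P.weightY, P.d, 1]

/-- The same weights as natural numbers; to be used only if the weight of `y` is positive. -/
def natWeight : Fin 4 → ℕ := ![P.ePlus, P.weightY.toNat, P.d, 1]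

theorem F_isWeightedHomogeneous_aux {M : Type} [AddCommMonoid M] (w : Fin 4 → M)
    (h2 : w 2 = P.d • w 3)
    (h1 : P.k • w 0 + w 1 = P.exponent • w 3 + P.Q.natDegree • w 2) :
    P.F.IsWeightedHomogeneous w (P.exponent • w 3 + P.Q.natDegree • w 2) := by
  have hX : ∀ (i : Fin 4) (n : ℕ),
      (X i ^ n : MvPolynomial (Fin 4) ℂ).IsWeightedHomogeneous w (n • w i) := fun i n =>
    (MvPolynomial.isWeightedHomogeneous_X ℂ w i).pow n
  refine MvPolynomial.IsWeightedHomogeneous.sub ?_ ?_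
  · rw [← h1]
    exact (hX 0 _).mul (MvPolynomial.isWeightedHomogeneous_X ℂ w 1)
  · refine (hX 3 _).mul ?_
    refine MvPolynomial.IsWeightedHomogeneous.sum _ _ _ fun j hj => ?_
    have hj' : j ≤ P.Q.natDegree := Nat.lt_succ_iff.1 (Finset.mem_range.1 hj)
    have := ((MvPolynomial.isWeightedHomogeneous_C w (P.Q.coeff j)).mul (hX 3 (P.d * j))).mul
      (hX 2 (P.Q.natDegree - j))
    convert this using 1
    rw [zero_add, mul_comm, mul_smul, ← h2, ← add_smul, Nat.add_sub_cancel' hj']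

theorem F_isWeightedHomogeneous : P.F.IsWeightedHomogeneous P.weight
    (P.exponent • P.weight 3 + P.Q.natDegree • P.weight 2) := by
  refine P.F_isWeightedHomogeneous_aux _ (by simp [weight]) ?_
  simp only [weight, weightY, Matrix.cons_val, nsmul_eq_mul, exponent_cast]
  ring

theorem F_isWeightedHomogeneous_nat (h : 0 < P.weightY) : P.F.IsWeightedHomogeneous P.natWeight
    (P.exponent • P.natWeight 3 + P.Q.natDegree • P.natWeight 2) := by
  refine P.F_isWeightedHomogeneous_aux _ (by simp [natWeight]) ?_
  simp only [natWeight, Matrix.cons_val, nsmul_eq_mul]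
  zify
  rw [Int.toNat_of_nonneg h.le, exponent_cast, weightY]
  ring

/-- The rescaling `x ↦ a x, y ↦ a^{-k} y, z ↦ z, s ↦ s`. -/
def torus (a : ℂˣ) : Fin 4 → ℂ := ![a, ((a ^ P.k)⁻¹ : ℂˣ), 1, 1]

theorem polyScale_F (a : ℂˣ) : polyScale (P.torus a) P.F = P.F := by
  have h : (C (a : ℂ) : MvPolynomial (Fin 4) ℂ) ^ P.k * C ((a ^ P.k)⁻¹ : ℂˣ).val = 1 := by
    rw [← map_pow, ← map_mul, ← Units.val_pow_eq_pow_val, ← Units.val_mul, mul_inv_cancel]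
    simp
  have hC : ∀ b : ℂ, polyScale (P.torus a) (C b) = C b := fun b =>
    MvPolynomial.aeval_C _ _
  have h0 : polyScale (P.torus a) (X 0) = C (a : ℂ) * X 0 := by simp [polyScale, torus]
  have h1 : polyScale (P.torus a) (X 1) = C ((a ^ P.k)⁻¹ : ℂˣ).val * X 1 := by
    simp only [polyScale, torus, MvPolynomial.aeval_X]; rfl
  have h2 : polyScale (P.torus a) (X 2) = X 2 := by simp [polyScale, torus]
  have h3 : polyScale (P.torus a) (X 3) = X 3 := by simp [polyScale, torus]
  simp only [F, homQ, map_sub, map_mul, map_pow, map_sum, hC, h0, h1, h2, h3]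
  linear_combination (X 0 ^ P.k * X 1) * h

theorem torus_one : P.torus 1 = 1 := by
  ext i; fin_cases i <;> simp [torus]

theorem torus_mul (a b : ℂˣ) : P.torus (a * b) = P.torus a * P.torus b := by
  ext i; fin_cases i <;> simp [torus, mul_pow, mul_comm]

/-- The action of `a ∈ ℂ^*` on the graded ring `ℂ[x, y, z, s] / (F)`. -/
def gradedAct {M : Type} [AddCommMonoid M] [DecidableEq M] (w : Fin 4 → M) (a : ℂˣ) :
    quotGrading w P.F →+*ᵍ quotGrading w P.F :=
  gradedScale w P.F (P.torus a) (P.polyScale_F a)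

theorem gradedAct_mk {M : Type} [AddCommMonoid M] [DecidableEq M] (w : Fin 4 → M) (a : ℂˣ)
    (p : MvPolynomial (Fin 4) ℂ) : P.gradedAct w a (Ideal.Quotient.mk _ p) =
      Ideal.Quotient.mk _ (polyScale (P.torus a) p) := rfl

theorem gradedAct_one {M : Type} [AddCommMonoid M] [DecidableEq M] (w : Fin 4 → M) :
    P.gradedAct w 1 = GradedRingHom.id _ := by
  refine DFunLike.ext _ _ fun q => ?_
  obtain ⟨p, rfl⟩ := Ideal.Quotient.mk_surjective q
  rw [gradedAct_mk, torus_one, polyScale_one]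
  rfl

theorem gradedAct_mul {M : Type} [AddCommMonoid M] [DecidableEq M] (w : Fin 4 → M) (a b : ℂˣ) :
    P.gradedAct w (a * b) = (P.gradedAct w a).comp (P.gradedAct w b) := by
  refine DFunLike.ext _ _ fun q => ?_
  obtain ⟨p, rfl⟩ := Ideal.Quotient.mk_surjective q
  rw [gradedAct_mk, torus_mul, ← polyScale_mul]
  rfl

theorem gradedAct_algebraMap {M : Type} [AddCommMonoid M] [DecidableEq M] (w : Fin 4 → M) (a : ℂˣ)
    (b : ℂ) : P.gradedAct w a (algebraMap ℂ (QuotRing P.F) b) = algebraMap ℂ (QuotRing P.F) b :=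
  (quotScale P.F (P.torus a) (P.polyScale_F a)).commutes b

/-- The class of `z` in `ℂ[x, y, z, s] / (F)`. -/
def z : QuotRing P.F := Ideal.Quotient.mk _ (X 2)

theorem gradedAct_z {M : Type} [AddCommMonoid M] [DecidableEq M] (w : Fin 4 → M) (a : ℂˣ) :
    P.gradedAct w a P.z = P.z := by
  rw [z, gradedAct_mk]
  congr 1
  simp [polyScale, torus]

/-- The surface `V = Spec A` for `A = ℂ[t][D₊, D₋]`, with the `ℂ^*`-action given by the grading. -/
def surface : ActedScheme :=
  ActedScheme.ofRing P.algebra (algebraMap ℂ P.algebra) P.toDivisorPair.act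
    P.toDivisorPair.act_one P.toDivisorPair.act_mul
    fun a => RingHom.ext (P.toDivisorPair.act_algebraMap a)

instance : GradedAlgebra (quotGrading P.weight P.F) :=
  quotGradedAlgebra _ _ _ P.F_isWeightedHomogeneous

/-- The ring `(R[1/z])₀`, where `R = ℂ[x, y, z, s] / (F)` is graded by the (possibly nonpositive)
integral weights. -/
abbrev chartRing : Type := HomogeneousLocalization.Away (quotGrading P.weight P.F) P.z

/-- The action of `a ∈ ℂ^*` on `(R[1/z])₀`. -/
def chartAct (a : ℂˣ) : P.chartRing →+* P.chartRing :=
  HomogeneousLocalization.map (P.gradedAct P.weight a)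
    (Submonoid.powers_le.2 ⟨1, (pow_one _).trans (P.gradedAct_z P.weight a).symm⟩)

/-- The structure homomorphism `ℂ → (R[1/z])₀`. -/
def chartStr : ℂ →+* P.chartRing :=
  (HomogeneousLocalization.fromZeroRingHom (quotGrading P.weight P.F) _).comp
    (algebraMap ℂ (quotGrading P.weight P.F 0))

theorem chartAct_one : P.chartAct 1 = RingHom.id _ :=
  localizationMap_of_eq_id _ _ _ (P.gradedAct_one _)

theorem chartAct_mul (a b : ℂˣ) : P.chartAct (a * b) = (P.chartAct a).comp (P.chartAct b) :=
  localizationMap_of_eq_comp _ _ _ _ _ _ _ (P.gradedAct_mul _ a b)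

theorem chartAct_str (a : ℂˣ) : (P.chartAct a).comp P.chartStr = P.chartStr :=
  localizationMap_comp_str _ _ _ _ (P.gradedAct_algebraMap _ a)

/-- The principal open set `{z ≠ 0}` of the hypersurface `F = 0`, as the affine scheme
`Spec (R[1/z])₀`, with the action `(x : y : z : s) ↦ (a x : a^{-k} y : z : s)` of `ℂ^*`. This makes
sense for arbitrary integral weights. -/
def chart : ActedScheme :=
  ActedScheme.ofRing P.chartRing P.chartStr P.chartAct P.chartAct_one P.chartAct_mul P.chartAct_str

section Projective

attribute [local instance] MvPolynomial.weightedGradedAlgebra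

/-- The weighted projective space `ℙ(w₀, w₁, w₂, w₃)` over `ℂ`. -/
def weightedProjectiveSpace (w : Fin 4 → ℕ) : Scheme.{0} :=
  Proj (MvPolynomial.weightedHomogeneousSubmodule ℂ w)

variable [hY : Fact (0 < P.weightY)]

instance : GradedAlgebra (quotGrading P.natWeight P.F) :=
  quotGradedAlgebra _ _ _ (P.F_isWeightedHomogeneous_nat hY.out)

/-- The hypersurface `V₊(F) = Proj (ℂ[x, y, z, s] / (F))`. -/
def hypersurface : Scheme.{0} := Proj (quotGrading P.natWeight P.F)

theorem irrelevant_le_map_mk :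
    HomogeneousIdeal.irrelevant (quotGrading P.natWeight P.F) ≤
      (HomogeneousIdeal.irrelevant (MvPolynomial.weightedHomogeneousSubmodule ℂ P.natWeight)).map
        (gradedMk P.natWeight P.F) := by
  rw [HomogeneousIdeal.irrelevant_le]
  rintro i hi _ ⟨p, hp, rfl⟩
  exact Ideal.mem_map_of_mem (gradedMk P.natWeight P.F)
    (HomogeneousIdeal.mem_irrelevant_of_mem _ hi hp)

/-- The embedding of the hypersurface `V₊(F)` into `ℙ(e₊, k e₋ + d deg Q, d, 1)`. -/
def embedding : P.hypersurface ⟶ weightedProjectiveSpace P.natWeight :=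
  Proj.map (gradedMk P.natWeight P.F) P.irrelevant_le_map_mk

theorem irrelevant_le_map_act (a : ℂˣ) :
    HomogeneousIdeal.irrelevant (quotGrading P.natWeight P.F) ≤
      (HomogeneousIdeal.irrelevant (quotGrading P.natWeight P.F)).map
        (P.gradedAct P.natWeight a) := by
  rw [HomogeneousIdeal.irrelevant_le]
  intro i hi q hq
  have h : P.gradedAct P.natWeight a (P.gradedAct P.natWeight a⁻¹ q) = q := by
    change ((P.gradedAct P.natWeight a).comp (P.gradedAct P.natWeight a⁻¹)) q = q
    rw [← gradedAct_mul, mul_inv_cancel, gradedAct_one]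
    rfl
  rw [← h]
  exact Ideal.mem_map_of_mem (P.gradedAct P.natWeight a)
    (HomogeneousIdeal.mem_irrelevant_of_mem _ hi ((P.gradedAct P.natWeight a⁻¹).map_mem hq))

/-- The automorphism `(x : y : z : s) ↦ (a x : a^{-k} y : z : s)` of the hypersurface `V₊(F)`. -/
def hypersurfaceAct (a : ℂˣ) : P.hypersurface ⟶ P.hypersurface :=
  Proj.map (P.gradedAct P.natWeight a) (P.irrelevant_le_map_act a)

/-- The structure morphism of the hypersurface. -/
def hypersurfaceStr : P.hypersurface ⟶ Spec (CommRingCat.of ℂ) :=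
  Proj.toSpecZero (quotGrading P.natWeight P.F) ≫
    Spec.map (CommRingCat.ofHom (algebraMap ℂ (quotGrading P.natWeight P.F 0)))

/-- The principal open subset `D₊(z)` of the hypersurface `V₊(F)`: the trace on `V₊(F)` of the open
set `z ≠ 0` of the weighted projective space. -/
def principalOpen : P.hypersurface.Opens :=
  P.embedding ⁻¹ᵁ Proj.basicOpen (MvPolynomial.weightedHomogeneousSubmodule ℂ P.natWeight) (X 2)

theorem principalOpen_eq :
    P.principalOpen = Proj.basicOpen (quotGrading P.natWeight P.F) P.z := rfl

theorem principalOpen_le (a : ℂˣ) : P.principalOpen ≤ P.hypersurfaceAct a ⁻¹ᵁ P.principalOpen := by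
  have h : P.hypersurfaceAct a ⁻¹ᵁ P.principalOpen =
    Proj.basicOpen (quotGrading P.natWeight P.F) (P.gradedAct P.natWeight a P.z) := rfl
  rw [h, gradedAct_z, ← principalOpen_eq]

theorem hypersurfaceAct_one : P.hypersurfaceAct 1 = 𝟙 _ :=
  projMap_of_eq_id _ _ (P.gradedAct_one _)

theorem hypersurfaceAct_mul (a b : ℂˣ) :
    P.hypersurfaceAct (a * b) = P.hypersurfaceAct a ≫ P.hypersurfaceAct b :=
  projMap_of_eq_comp (P.gradedAct _ b) (P.gradedAct _ a) (P.gradedAct _ (a * b)) _ _ _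
    (P.gradedAct_mul _ a b)

theorem hypersurfaceAct_str (a : ℂˣ) :
    P.hypersurfaceAct a ≫ P.hypersurfaceStr = P.hypersurfaceStr :=
  projMap_str _ _ (P.gradedAct_algebraMap _ a)

/-- The principal open subset `D₊(z)` of the hypersurface `V₊(F)` in the weighted projective space
`ℙ(e₊, k e₋ + d deg Q, d, 1)`, with the action `(x : y : z : s) ↦ (a x : a^{-k} y : z : s)`. -/
def openPart : ActedScheme where
  toScheme := P.principalOpen
  str := P.principalOpen.ι ≫ P.hypersurfaceStr
  act a := (P.hypersurfaceAct a).resLE P.principalOpen P.principalOpen (P.principalOpen_le a)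
  act_one := by
    rw [← cancel_mono P.principalOpen.ι, Scheme.Hom.resLE_comp_ι, hypersurfaceAct_one]
    simp
  act_mul a b := by
    rw [← cancel_mono P.principalOpen.ι, Scheme.Hom.resLE_comp_ι, hypersurfaceAct_mul]
    simp
  act_str a := by
    rw [Scheme.Hom.resLE_comp_ι_assoc, hypersurfaceAct_str]

end Projective

end Presentation

end CStarSurface

end

noncomputable section

namespace CStarSurface

/-! ### Orders of polynomials -/

/-! Write `B` for the degree zero part of `R[1/z]`. Since `s` has weight one, setting `s = 1` loses
nothing on homogeneous elements. On `F = 0` it turns `z` into `t⁻¹`, `x` into `u` and `y` into `Q(t)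
t^{-deg Q} u^{-k}`, so that `p / zⁿ` in `B` becomes the Laurent polynomial `tⁿ p(u, Q(t) t^{-deg Q}
u^{-k}, t⁻¹, 1)`. This map identifies `B` with a subring of `A`, and `A` is the normalization of
that subring.

The values lie in `A` by a computation of orders on monomials, in which `e₊ + e₋ ≥ 0` enters
(`allowed_monomial`). The map is injective because a homogeneous polynomial that it kills also
vanishes after `F = 0` is solved for `y`, and hence is divisible by `F`, as `x` is a prime not
dividing `F` (`rehom_dehom`, `mem_span_of_solveY_eq_zero`).

`A` is integral over `B`: a homogeneous element `f uⁱ` has a power that is a polynomial in `t` times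
a power of `x^d / z^{e₊}` or of `y^d` divided by the power of `z` of the same weight
(`pow_mem_of_nonneg`, `pow_mem_of_neg`). The extension is birational: elements of `A` have poles at
most along `t = 0`, so a high power of `t² u` multiplies each of them into `B` (`eventually_mem`).

`A` is normal since it is completely integrally closed in `ℂ(t)[u, u⁻¹]`, itself a normal ring with
the same fraction field: leading coefficients reduce this to the fact that the inequality `div f +
iD ≥ 0` can be tested on high powers of `f` (`allowed_of_forall_pow`).

Equivariance holds because the torus weights `1, -k, 0, 0` of the variables are the `u`-degrees of
their images. The integral grading and, when the weight of `y` is positive, the natural one are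
treated together through `IsWeight`; in the latter case the spectrum of `B` is the open set `z ≠ 0`
of `Proj R`. -/

theorem ord_algebraMap (c : ℂ) (q : ℂ[X]) :
    ord c (algebraMap ℂ[X] (RatFunc ℂ) q) = q.rootMultiplicity c := by
  simp [ord]

theorem algebraMap_ratFunc_ne_zero {q : ℂ[X]} (hq : q ≠ 0) :
    algebraMap ℂ[X] (RatFunc ℂ) q ≠ 0 :=
  RatFunc.algebraMap_ne_zero hq

theorem ord_one (c : ℂ) : ord c 1 = 0 := by simp [ord]

theorem ord_pow {f : RatFunc ℂ} (hf : f ≠ 0) (c : ℂ) (n : ℕ) : ord c (f ^ n) = n * ord c f := by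
  induction n with
  | zero => simp [ord_one]
  | succ n ih => rw [pow_succ, ord_mul (pow_ne_zero _ hf) hf, ih]; push_cast; ring

theorem ord_inv {f : RatFunc ℂ} (hf : f ≠ 0) (c : ℂ) : ord c f⁻¹ = -ord c f := by
  have h := ord_mul hf (inv_ne_zero hf) c
  rw [mul_inv_cancel₀ hf, ord_one] at h
  omega

theorem ord_zpow {f : RatFunc ℂ} (hf : f ≠ 0) (c : ℂ) (n : ℤ) : ord c (f ^ n) = n * ord c f := by
  cases n with
  | ofNat n => simpa using ord_pow hf c n
  | negSucc n =>
    rw [zpow_negSucc, ord_inv (pow_ne_zero _ hf), ord_pow hf, Int.negSucc_eq]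
    push_cast
    ring

/-- A rational function without poles on the affine line is a polynomial. -/
theorem exists_polynomial_of_ord_nonneg {f : RatFunc ℂ} (h : ∀ c, 0 ≤ ord c f) :
    ∃ q : ℂ[X], f = algebraMap ℂ[X] (RatFunc ℂ) q := by
  have hunit : f.denom.natDegree = 0 := by
    -- A nonconstant denominator has a root over `ℂ`. By coprimality the numerator does not vanish
    -- there, so the order is negative.
    by_contra hd
    obtain ⟨c, hc⟩ := IsAlgClosed.exists_root f.denom
      (fun h0 => hd (Polynomial.natDegree_eq_of_degree_eq_some h0))
    have hpos := (Polynomial.rootMultiplicity_pos (RatFunc.denom_ne_zero f)).2 hc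
    have hnum : f.num.rootMultiplicity c = 0 := by
      refine Polynomial.rootMultiplicity_eq_zero fun hn => ?_
      obtain ⟨a, b, hab⟩ := RatFunc.isCoprime_num_denom f
      have := congrArg (Polynomial.eval c) hab
      simp [hn.eq_zero, hc.eq_zero] at this
    have := h c
    unfold ord at this
    omega
  have h1 : f.denom = 1 := by
    rw [Polynomial.eq_C_of_natDegree_eq_zero hunit]
    have := RatFunc.monic_denom f
    rw [Polynomial.Monic, Polynomial.leadingCoeff, hunit] at this
    rw [this, Polynomial.C_1]
  refine ⟨f.num, ?_⟩
  conv_lhs => rw [← RatFunc.num_div_denom f, h1]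
  simp

/-! ### Leading coefficients of Laurent polynomials -/

/-- Laurent polynomials multiply their coefficients in the top degree. -/
theorem coeff_mul_top {R : Type*} [Semiring R] {p q : R[T;T⁻¹]} {i j : ℤ}
    (hp : ∀ m, i < m → p.coeff m = 0) (hq : ∀ m, j < m → q.coeff m = 0) :
    (p * q).coeff (i + j) = p.coeff i * q.coeff j ∧ ∀ m, i + j < m → (p * q).coeff m = 0 := by
  have hle : ∀ {r : R[T;T⁻¹]} {n a : ℤ}, (∀ m, n < m → r.coeff m = 0) → a ∈ r.coeff.support →
      a ≤ n := fun h ha => by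
    by_contra hlt
    exact (Finsupp.mem_support_iff.1 ha) (h _ (not_le.1 hlt))
  constructor
  · refine AddMonoidAlgebra.coeff_mul_add_of_uniqueAdd fun a b ha hb hab => ?_
    have := hle hp ha
    have := hle hq hb
    omega
  · intro m hm
    rw [AddMonoidAlgebra.coeff_mul]
    refine Finset.sum_eq_zero fun a ha => Finset.sum_eq_zero fun b hb => if_neg fun hab => ?_
    have := hle hp ha
    have := hle hq hb
    omega

/-- Applied with `p` almost integral and `q` its common denominator: it turns `q pⁿ ∈ A` for all `n`
into a condition on the leading coefficients alone. -/
theorem coeff_mul_pow_top {R : Type*} [Semiring R] {p q : R[T;T⁻¹]} {i j : ℤ}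
    (hp : ∀ m, i < m → p.coeff m = 0) (hq : ∀ m, j < m → q.coeff m = 0) (n : ℕ) :
    (q * p ^ n).coeff (j + n * i) = q.coeff j * p.coeff i ^ n ∧
      ∀ m, j + n * i < m → (q * p ^ n).coeff m = 0 := by
  induction n with
  | zero => simpa using hq
  | succ n ih =>
    have h := coeff_mul_top ih.2 hp
    rw [pow_succ, ← mul_assoc, pow_succ, ← mul_assoc, ← ih.1]
    have e : j + ((n + 1 : ℕ) : ℤ) * i = j + n * i + i := by push_cast; ring
    rw [e]
    exact h

/-- A nonzero Laurent polynomial has a top degree. -/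
theorem exists_top {R : Type*} [Semiring R] {p : R[T;T⁻¹]} (hp : p ≠ 0) :
    ∃ i, p.coeff i ≠ 0 ∧ ∀ m, i < m → p.coeff m = 0 := by
  have hne : p.coeff.support.Nonempty := by
    rw [Finsupp.support_nonempty_iff]
    intro h
    exact hp (LaurentPolynomial.ext fun a => by rw [h]; rfl)
  refine ⟨p.coeff.support.max' hne, Finsupp.mem_support_iff.1 (Finset.max'_mem _ hne),
    fun m hm => ?_⟩
  by_contra h
  exact absurd (Finset.le_max' _ m (Finsupp.mem_support_iff.2 h)) (not_le.2 hm)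

/-! ### Normality of the algebra of a pair of divisors -/

namespace DivisorPair

variable (D : DivisorPair)

theorem single_mem_algebra {i : ℤ} {f : RatFunc ℂ} (h : D.Allowed i f) :
    (AddMonoidAlgebra.single i f : (RatFunc ℂ)[T;T⁻¹]) ∈ D.algebra := by
  intro j
  rw [AddMonoidAlgebra.coeff_single, Finsupp.single_apply]
  split_ifs with hij
  · exact hij ▸ h
  · exact Allowed.zero j

theorem allowed_polynomial (q : ℂ[X]) : D.Allowed 0 (algebraMap ℂ[X] (RatFunc ℂ) q) := by
  intro _ c
  rw [ord_algebraMap]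
  simp [bound]

theorem bound_nat_mul (n : ℕ) (i : ℤ) (c : ℂ) : D.bound (n * i) c = n * D.bound i c := by
  unfold bound
  rcases Nat.eq_zero_or_pos n with rfl | hn
  · simp
  · have : 0 ≤ (n : ℤ) * i ↔ 0 ≤ i := by
      constructor
      · intro h
        by_contra hi
        nlinarith [(by exact_mod_cast hn : (0 : ℤ) < n)]
      · intro h; positivity
    simp only [this]
    split_ifs <;> push_cast <;> ring

theorem bound_eq_zero {c : ℂ} (hp : D.plus c = 0) (hm : D.minus c = 0) (i : ℤ) :
    D.bound i c = 0 := by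
  simp [bound, hp, hm]

/-- If `g fⁿ` is allowed in degree `j + n i` for all `n`, then `f` is allowed in degree `i`. -/
theorem allowed_of_forall_pow {i j : ℤ} {f g : RatFunc ℂ} (hg : g ≠ 0)
    (h : ∀ n : ℕ, D.Allowed (j + n * i) (g * f ^ n)) : D.Allowed i f := by
  intro hf c
  by_contra hneg
  rw [not_le] at hneg
  -- By superadditivity, `bound (j + n i) ≤ n bound i - bound (-j)`. Allowedness of `g fⁿ` thus
  -- bounds `n` times the positive defect `-(ord f + bound i)` by `ord g - bound (-j)`; a larger `n`
  -- contradicts this.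
  obtain ⟨n, hn⟩ := exists_nat_gt (((ord c g : ℚ) - D.bound (-j) c) / -(ord c f + D.bound i c))
  rw [div_lt_iff₀ (by linarith)] at hn
  have h1 := h n (mul_ne_zero hg (pow_ne_zero n hf)) c
  rw [ord_mul hg (pow_ne_zero n hf), ord_pow hf] at h1
  have h2 := D.bound_add_le (j + n * i) (-j) c
  rw [show j + n * i + -j = n * i by ring, bound_nat_mul] at h2
  push_cast at h1
  nlinarith

/-- The algebra of a pair of divisors is completely integrally closed in `ℂ(t)[u, u⁻¹]`. -/
theorem mem_algebra_of_isAlmostIntegral {p : (RatFunc ℂ)[T;T⁻¹]}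
    (hp : IsAlmostIntegral D.algebra p) : p ∈ D.algebra := by
  -- Induction on the number of nonzero components: the leading one is shown to lie in the algebra
  -- and is then removed.
  induction hn : p.coeff.support.card using Nat.strong_induction_on generalizing p with
  | _ n ih =>
  by_cases h0 : p = 0
  · rw [h0]; exact zero_mem _
  obtain ⟨i, hi, htop⟩ := exists_top h0
  have hlead : (AddMonoidAlgebra.single i (p.coeff i) : (RatFunc ℂ)[T;T⁻¹]) ∈ D.algebra := by
    apply D.single_mem_algebra
    obtain ⟨r, hr, hmem⟩ := hp
    have hr0 : (r : (RatFunc ℂ)[T;T⁻¹]) ≠ 0 := by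
      simpa using nonZeroDivisors.ne_zero hr
    obtain ⟨j, hj, hjtop⟩ := exists_top hr0
    refine D.allowed_of_forall_pow (j := j) hj fun n => ?_
    obtain ⟨a, ha⟩ := hmem n
    rw [← (coeff_mul_pow_top htop hjtop n).1]
    have : (r : (RatFunc ℂ)[T;T⁻¹]) * p ^ n = a := ha.symm
    rw [this]
    exact a.2 _
  -- Almost integral elements form a ring, so the difference is still almost integral; its support
  -- has lost the index `i` and gained nothing.
  have hsub : p - AddMonoidAlgebra.single i (p.coeff i) ∈ D.algebra := by
    refine ih _ ?_ ?_ rfl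
    · rw [← hn]
      refine Finset.card_lt_card ((Finset.ssubset_iff_of_subset fun m hm => ?_).2
        ⟨i, Finsupp.mem_support_iff.2 hi, ?_⟩)
      · rw [Finsupp.mem_support_iff] at hm ⊢
        intro hpm
        apply hm
        rw [AddMonoidAlgebra.coeff_sub, Finsupp.sub_apply, AddMonoidAlgebra.coeff_single,
          Finsupp.single_apply, hpm]
        split_ifs with h
        · rw [h, hpm, sub_zero]
        · rw [sub_zero]
      · rw [Finsupp.notMem_support_iff, AddMonoidAlgebra.coeff_sub, Finsupp.sub_apply,
          AddMonoidAlgebra.coeff_single, Finsupp.single_eq_same, sub_self]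
    · exact (completeIntegralClosure D.algebra (RatFunc ℂ)[T;T⁻¹]).sub_mem hp
        ((completeIntegralClosure D.algebra (RatFunc ℂ)[T;T⁻¹]).algebraMap_mem ⟨_, hlead⟩)
  simpa using add_mem hsub hlead

/-- Only the finitely many points of the two supports matter, and a high power of the product of the
`X - c` over them suffices. -/
theorem exists_polynomial_bound (i : ℤ) : ∃ g : ℂ[X], g ≠ 0 ∧
    ∀ c, 0 ≤ (g.rootMultiplicity c : ℚ) + D.bound i c := by
  classical
  set S := D.plus.support ∪ D.minus.support
  obtain ⟨N, hN⟩ : ∃ N : ℕ, ∀ c ∈ S, -D.bound i c ≤ N := by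
    obtain ⟨b, hb⟩ := (S.finite_toSet.image fun c => -D.bound i c).bddAbove
    obtain ⟨N, hN⟩ := exists_nat_ge b
    exact ⟨N, fun c hc => (hb ⟨c, hc, rfl⟩).trans hN⟩
  have hg : (∏ c ∈ S, (Polynomial.X - Polynomial.C c) ^ N : ℂ[X]) ≠ 0 :=
    Finset.prod_ne_zero_iff.2 fun c _ => pow_ne_zero _ (Polynomial.X_sub_C_ne_zero c)
  refine ⟨_, hg, fun c => ?_⟩
  by_cases hc : c ∈ S
  · have : N ≤ (∏ c ∈ S, (Polynomial.X - Polynomial.C c) ^ N : ℂ[X]).rootMultiplicity c :=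
      (Polynomial.le_rootMultiplicity_iff hg).2 (Finset.dvd_prod_of_mem _ hc)
    have : (N : ℚ) ≤ (∏ c ∈ S, (Polynomial.X - Polynomial.C c) ^ N : ℂ[X]).rootMultiplicity c := by
      exact_mod_cast this
    linarith [hN c hc]
  · rw [Finset.mem_union, not_or, Finsupp.notMem_support_iff, Finsupp.notMem_support_iff] at hc
    rw [D.bound_eq_zero hc.1 hc.2]
    positivity

/-- The element of the algebra given by a polynomial in `t`. -/
theorem C_polynomial_mem (q : ℂ[X]) :
    (LaurentPolynomial.C (algebraMap ℂ[X] (RatFunc ℂ) q) : (RatFunc ℂ)[T;T⁻¹]) ∈ D.algebra :=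
  D.single_mem_algebra (D.allowed_polynomial q)

/-- Common denominators can be chosen in `ℂ[t]`: the denominator of each coefficient is cleared, and
the divisor conditions are met by `exists_polynomial_bound`. -/
theorem exists_polynomial_mul_mem (p : (RatFunc ℂ)[T;T⁻¹]) : ∃ q : ℂ[X], q ≠ 0 ∧
    LaurentPolynomial.C (algebraMap ℂ[X] (RatFunc ℂ) q) * p ∈ D.algebra := by
  induction p using LaurentPolynomial.induction_on' with
  | add p₁ p₂ h₁ h₂ =>
    obtain ⟨q₁, hq₁, hm₁⟩ := h₁
    obtain ⟨q₂, hq₂, hm₂⟩ := h₂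
    refine ⟨q₁ * q₂, mul_ne_zero hq₁ hq₂, ?_⟩
    have := add_mem (mul_mem (D.C_polynomial_mem q₂) hm₁) (mul_mem (D.C_polynomial_mem q₁) hm₂)
    convert this using 1
    simp only [map_mul]
    ring
  | C_mul_T i f =>
    obtain ⟨g, hg, hb⟩ := D.exists_polynomial_bound i
    refine ⟨g * f.denom, mul_ne_zero hg f.denom_ne_zero, ?_⟩
    rw [← mul_assoc, ← map_mul, ← LaurentPolynomial.single_eq_C_mul_T]
    apply D.single_mem_algebra
    have hd : algebraMap ℂ[X] (RatFunc ℂ) f.denom ≠ 0 :=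
      algebraMap_ratFunc_ne_zero f.denom_ne_zero
    have hf : algebraMap ℂ[X] (RatFunc ℂ) (g * f.denom) * f =
        algebraMap ℂ[X] (RatFunc ℂ) (g * f.num) := by
      have h := RatFunc.num_div_denom f
      rw [div_eq_iff hd] at h
      rw [map_mul, map_mul, h]
      ring
    rw [hf]
    intro hne c
    have hne' : g * f.num ≠ 0 := fun h => hne (by rw [h, map_zero])
    rw [ord_algebraMap, Polynomial.rootMultiplicity_mul hne']
    have := hb c
    push_cast
    have h2 : (0 : ℚ) ≤ f.num.rootMultiplicity c := by positivity
    linarith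

/-- Laurent polynomials are the localization of `K[X]` at the powers of `X`, and normality survives
localization. -/
theorem laurent_isIntegrallyClosed (K : Type*) [Field K] : IsIntegrallyClosed K[T;T⁻¹] :=
  isIntegrallyClosed_of_isLocalization (R := K[X]) K[T;T⁻¹]
    (Submonoid.powers (Polynomial.X : K[X]))
    (powers_le_nonZeroDivisors_of_noZeroDivisors Polynomial.X_ne_zero)

/-- Numerator and denominator of a fraction of Laurent polynomials enter the algebra after
multiplication by one common nonzero polynomial in `t`. -/
instance isFractionRing_algebra :
    IsFractionRing D.algebra (FractionRing (RatFunc ℂ)[T;T⁻¹]) := by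
  have hC : ∀ {q : ℂ[X]}, q ≠ 0 →
      (LaurentPolynomial.C (algebraMap ℂ[X] (RatFunc ℂ) q) : (RatFunc ℂ)[T;T⁻¹]) ≠ 0 := by
    intro q hq h
    have := congrArg (fun p => p.coeff 0) h
    simp at this
    exact hq this
  refine IsFractionRing.of_field _ _ fun z => ?_
  obtain ⟨a, b, hb, rfl⟩ := IsFractionRing.div_surjective (A := (RatFunc ℂ)[T;T⁻¹]) z
  obtain ⟨q₁, hq₁, h₁⟩ := D.exists_polynomial_mul_mem a
  obtain ⟨q₂, hq₂, h₂⟩ := D.exists_polynomial_mul_mem b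
  refine ⟨⟨_, mul_mem (D.C_polynomial_mem q₂) h₁⟩, ⟨_, mul_mem (D.C_polynomial_mem q₁) h₂⟩, ?_⟩
  change _ = algebraMap (RatFunc ℂ)[T;T⁻¹] _ (LaurentPolynomial.C _ * (LaurentPolynomial.C _ * _)) /
    algebraMap (RatFunc ℂ)[T;T⁻¹] _ (LaurentPolynomial.C _ * (LaurentPolynomial.C _ * _))
  rw [map_mul, map_mul, map_mul, map_mul]
  have e : ∀ {q : (RatFunc ℂ)[T;T⁻¹]}, q ≠ 0 →
      algebraMap (RatFunc ℂ)[T;T⁻¹] (FractionRing (RatFunc ℂ)[T;T⁻¹]) q ≠ 0 := fun h =>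
    (map_ne_zero_iff _ (IsFractionRing.injective _ _)).2 h
  have e₁ := e (hC hq₁)
  have e₂ := e (hC hq₂)
  have e₃ := e (nonZeroDivisors.ne_zero hb)
  field_simp

/-- An integral fraction is first a Laurent polynomial `p`, by normality of the Laurent ring. Some
polynomial in `t` multiplies `p` into the algebra, so the integral element `p` is almost integral,
and complete integral closedness applies. -/
instance isIntegrallyClosed_algebra : IsIntegrallyClosed D.algebra := by
  have := laurent_isIntegrallyClosed (RatFunc ℂ)
  rw [isIntegrallyClosed_iff (FractionRing (RatFunc ℂ)[T;T⁻¹])]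
  intro x hx
  obtain ⟨p, rfl⟩ := IsIntegrallyClosed.isIntegral_iff.1 (hx.tower_top (A := (RatFunc ℂ)[T;T⁻¹]))
  rw [isIntegral_algebraMap_iff (IsFractionRing.injective _ _)] at hx
  obtain ⟨q, hq, hmem⟩ := D.exists_polynomial_mul_mem p
  have : p ∈ D.algebra := by
    refine D.mem_algebra_of_isAlmostIntegral (hx.isAlmostIntegral_of_exists_smul_mem_range
      ⟨⟨_, D.C_polynomial_mem q⟩, ?_, ⟨⟨_, hmem⟩, rfl⟩⟩)
    rw [mem_nonZeroDivisors_iff_ne_zero]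
    intro h
    have := congrArg (fun p : D.algebra => p.1.coeff 0) h
    simp at this
    exact hq this
  exact ⟨⟨p, this⟩, rfl⟩

end DivisorPair

/-! ### Normalizations of affine schemes -/

/-- The element `h` is a conductor-like denominator: inverting it makes `φ` surjective, hence
bijective, which gives birationality on the open set `h ≠ 0`. Stalks are localizations of the normal
domain `A`. -/
theorem isNormalization_specMap {B A : Type} [CommRing B] [CommRing A] [IsDomain A]
    [IsIntegrallyClosed A] (φ : B →+* A) (hinj : Function.Injective φ) (hint : φ.IsIntegral)
    (h : B) (h0 : φ h ≠ 0) (hsurj : ∀ a, ∃ (b : B) (n : ℕ), φ b = φ h ^ n * a) :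
    IsNormalization (Spec.map (CommRingCat.ofHom φ)) := by
  have : IsDomain B := hinj.isDomain φ
  refine ⟨inferInstance, inferInstance, fun v => ?_, ?_, PrimeSpectrum.basicOpen h, ?_, ?_⟩
  · have hv : v.asIdeal.IsPrime := v.isPrime
    have := isIntegrallyClosed_of_isLocalization (R := A) (Localization.AtPrime v.asIdeal)
      v.asIdeal.primeCompl v.asIdeal.primeCompl_le_nonZeroDivisors
    exact IsIntegrallyClosed.of_equiv (Spec.stalkIso (.of A) v).commRingCatIsoToRingEquiv.symm
  · rw [IsIntegralHom.SpecMap_iff]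
    exact hint
  · refine ⟨(⊥ : PrimeSpectrum B), ?_⟩
    change h ∉ (⊥ : Ideal B)
    rw [Ideal.mem_bot]
    rintro rfl
    exact h0 (map_zero φ)
  · have e := SpecMapRestrictBasicOpenIso (CommRingCat.ofHom φ) h
    have : IsIso (CommRingCat.ofHom (Localization.awayMap φ h)) :=
      (ConcreteCategory.isIso_iff_bijective _).2 ⟨Localization.awayMap_injective_iff.2
        fun a ha => ⟨0, by rw [(map_eq_zero_iff φ hinj).1 ha, mul_zero]⟩,
        Localization.awayMap_surjective_iff.2 hsurj⟩
    exact ((MorphismProperty.isomorphisms Scheme).arrow_mk_iso_iff e).2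
      (inferInstanceAs (IsIso (Spec.map (CommRingCat.ofHom (Localization.awayMap φ h)))))

theorem IsNormalization.comp_iso {V X Y : Scheme.{0}} {ν : V ⟶ X} (h : IsNormalization ν)
    (e : X ≅ Y) : IsNormalization (ν ≫ e.hom) := by
  have := h.isIntegral_source
  have := h.isIntegral_target
  have := h.isIntegralHom
  have : Nonempty Y := ⟨e.hom (Classical.arbitrary X)⟩
  refine ⟨inferInstance, isIntegral_of_isOpenImmersion e.inv, h.normal, inferInstance, ?_⟩
  obtain ⟨U, ⟨x, hx⟩, hU⟩ := h.birational
  have hpre : e.hom ⁻¹ᵁ e.inv ⁻¹ᵁ U = U := by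
    rw [← Scheme.Hom.comp_preimage, e.hom_inv_id, Scheme.Hom.id_preimage]
  refine ⟨e.inv ⁻¹ᵁ U, ⟨e.hom x, ?_⟩, ?_⟩
  · change x ∈ U at hx
    rw [← hpre] at hx
    exact hx
  · rw [morphismRestrict_comp]
    have : IsIso (ν ∣_ (e.hom ⁻¹ᵁ e.inv ⁻¹ᵁ U)) := by rw [hpre]; exact hU
    exact @IsIso.comp_isIso _ _ _ _ _ _ _ this inferInstance

theorem mem_range_algebraMap_of_isAlgebraic {k K : Type*} [Field k] [IsAlgClosed k] [Field K]
    [Algebra k K] {x : K} (hx : IsAlgebraic k x) : x ∈ (algebraMap k K).range :=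
  minpoly.mem_range_of_degree_eq_one k x
    (IsAlgClosed.degree_eq_one_of_irreducible k (minpoly.irreducible hx.isIntegral))

/-- Rescaling the values of the variables by powers of a unit according to the weights rescales the
value of a weighted homogeneous polynomial. -/
theorem aeval_mul_zpow {σ K : Type*} [Field K] [Algebra ℂ K] {w : σ → ℤ} {m : ℤ}
    {p : MvPolynomial σ ℂ} (hp : p.IsWeightedHomogeneous w m) (g : σ → K) {b : K} (hb : b ≠ 0) :
    MvPolynomial.aeval (fun i => g i * b ^ w i) p = MvPolynomial.aeval g p * b ^ m := by
  rw [p.as_sum, map_sum, map_sum, Finset.sum_mul]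
  refine Finset.sum_congr rfl fun e he => ?_
  rw [MvPolynomial.aeval_monomial, MvPolynomial.aeval_monomial, mul_assoc,
    ← hp (MvPolynomial.mem_support_iff.1 he), Finsupp.weight_apply]
  congr 1
  simp only [Finsupp.prod, Finsupp.sum, mul_pow, Finset.prod_mul_distrib]
  congr 1
  classical
  induction e.support using Finset.induction_on with
  | empty => simp
  | insert a s ha ih =>
    rw [Finset.prod_insert ha, Finset.sum_insert ha, zpow_add₀ hb, ih, nsmul_eq_mul, mul_comm,
      mul_comm (e a : ℤ), zpow_mul, zpow_natCast, mul_comm]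

namespace Presentation

open MvPolynomial (X C)

variable (P : Presentation)

theorem Q_ne_zero : P.Q ≠ 0 := fun h => P.eval_Q (by simp [h])

/-- The coordinate `t`. -/
abbrev t : RatFunc ℂ := RatFunc.X

/-- The rational function `Q(t)`. -/
def q : RatFunc ℂ := algebraMap ℂ[X] (RatFunc ℂ) P.Q

theorem t_ne_zero : t ≠ 0 := RatFunc.X_ne_zero

theorem q_ne_zero : P.q ≠ 0 := algebraMap_ratFunc_ne_zero P.Q_ne_zero

theorem aeval_t (r : ℂ[X]) : Polynomial.aeval t r = algebraMap ℂ[X] (RatFunc ℂ) r := by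
  rw [t, ← RatFunc.algebraMap_X, Polynomial.aeval_algebraMap_apply, Polynomial.aeval_X_left_apply]

/-- Here `τ` plays the role of `s^d / z`, without `z` having to be invertible. It is used with `τ =
t` after dehomogenization and with `τ = s^d / z` in the function field. -/
theorem map_homQ {S : Type*} [CommRing S] [Algebra ℂ S] (g : MvPolynomial (Fin 4) ℂ →ₐ[ℂ] S) (τ : S)
    (hτ : τ * g (X 2) = g (X 3) ^ P.d) :
    g P.homQ = g (X 2) ^ P.Q.natDegree * Polynomial.aeval τ P.Q := by
  rw [homQ, map_sum, Polynomial.aeval_eq_sum_range, Finset.mul_sum]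
  refine Finset.sum_congr rfl fun j hj => ?_
  have hj' : j ≤ P.Q.natDegree := Nat.lt_succ_iff.1 (Finset.mem_range.1 hj)
  rw [map_mul, map_mul, map_pow, map_pow, pow_mul, ← hτ, mul_pow, Algebra.smul_def,
    ← MvPolynomial.algebraMap_eq, AlgHom.commutes]
  conv_rhs => rw [← Nat.sub_add_cancel hj', pow_add]
  ring

/-! ### Dehomogenization with respect to `s` -/

/-- The homomorphism `x ↦ u, y ↦ Q(t) t^{-deg Q} u^{-k}, z ↦ t⁻¹, s ↦ 1`. -/
def dehom : MvPolynomial (Fin 4) ℂ →ₐ[ℂ] (RatFunc ℂ)[T;T⁻¹] :=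
  MvPolynomial.aeval ![LaurentPolynomial.T 1,
    LaurentPolynomial.C (P.q * t⁻¹ ^ P.Q.natDegree) * LaurentPolynomial.T (-(P.k : ℤ)),
    LaurentPolynomial.C t⁻¹, 1]

theorem dehom_x : P.dehom (X 0) = LaurentPolynomial.T 1 := by simp [dehom]

theorem dehom_y : P.dehom (X 1) = LaurentPolynomial.C (P.q * t⁻¹ ^ P.Q.natDegree) *
    LaurentPolynomial.T (-(P.k : ℤ)) := by
  simp only [dehom, MvPolynomial.aeval_X]; rfl

theorem dehom_z : P.dehom (X 2) = LaurentPolynomial.C t⁻¹ := by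
  simp only [dehom, MvPolynomial.aeval_X]; rfl

theorem dehom_s : P.dehom (X 3) = 1 := by
  simp only [dehom, MvPolynomial.aeval_X]; rfl

theorem C_t_mul_C_inv :
    (LaurentPolynomial.C t * LaurentPolynomial.C t⁻¹ : (RatFunc ℂ)[T;T⁻¹]) = 1 := by
  rw [← map_mul, mul_inv_cancel₀ t_ne_zero, map_one]

theorem aeval_C_t (r : ℂ[X]) : Polynomial.aeval (LaurentPolynomial.C t : (RatFunc ℂ)[T;T⁻¹]) r =
    LaurentPolynomial.C (algebraMap ℂ[X] (RatFunc ℂ) r) := by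
  rw [← aeval_t, LaurentPolynomial.C_eq_algebraMap, LaurentPolynomial.C_eq_algebraMap,
    Polynomial.aeval_algebraMap_apply]

theorem dehom_F : P.dehom P.F = 0 := by
  rw [F, map_sub, map_mul, map_mul, map_pow, map_pow,
    P.map_homQ P.dehom (LaurentPolynomial.C t) (by rw [dehom_z, dehom_s, C_t_mul_C_inv, one_pow]),
    dehom_x, dehom_y, dehom_z, dehom_s, aeval_C_t, ← map_pow, ← map_mul, LaurentPolynomial.T_pow,
    mul_left_comm, ← LaurentPolynomial.T_add, q]
  simp [mul_comm]

/-- Monomials go to homogeneous elements of degree `e 0 - k e 1` in `u`, so membership in the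
algebra can be checked monomial by monomial. -/
theorem dehom_monomial (e : Fin 4 →₀ ℕ) (c : ℂ) : P.dehom (MvPolynomial.monomial e c) =
    AddMonoidAlgebra.single ((e 0 : ℤ) - P.k * e 1)
      (algebraMap ℂ (RatFunc ℂ) c * P.q ^ e 1 * t ^ (-((P.Q.natDegree : ℤ) * e 1 + e 2))) := by
  have hC : P.dehom (C c) = LaurentPolynomial.C (algebraMap ℂ (RatFunc ℂ) c) := by
    rw [← MvPolynomial.algebraMap_eq, AlgHom.commutes, LaurentPolynomial.algebraMap_apply]
  rw [MvPolynomial.monomial_eq, Finsupp.prod_fintype _ _ (by simp), Fin.prod_univ_four]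
  simp only [map_mul, map_pow, hC, dehom_x, dehom_y, dehom_z, dehom_s, one_pow, mul_one]
  rw [LaurentPolynomial.single_eq_C_mul_T, mul_pow, LaurentPolynomial.T_pow,
    LaurentPolynomial.T_pow, sub_eq_add_neg, LaurentPolynomial.T_add, mul_one, zpow_neg,
    zpow_add₀ t_ne_zero, zpow_mul, zpow_natCast, zpow_natCast, zpow_natCast]
  simp only [map_mul, map_pow, mul_pow, mul_inv, ← inv_pow]
  rw [show -((P.k : ℤ) * e 1) = e 1 * -P.k by ring]
  ring

/-! ### The kernel of the dehomogenization on homogeneous polynomials -/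

/-- The polynomial `s^{k(e₊ + e₋)} Q(s^d/z) z^{deg Q}`. -/
def G : MvPolynomial (Fin 4) ℂ := X 3 ^ P.exponent * P.homQ

theorem F_eq : P.F = X 0 ^ P.k * X 1 - P.G := rfl

/-- The field `ℂ(x, y, z, s)`. -/
abbrev FunField : Type := FractionRing (MvPolynomial (Fin 4) ℂ)

/-- A variable as a rational function. -/
def var (i : Fin 4) : FunField := algebraMap (MvPolynomial (Fin 4) ℂ) FunField (X i)

theorem algebraMap_funField_injective :
    Function.Injective (algebraMap (MvPolynomial (Fin 4) ℂ) FunField) :=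
  IsFractionRing.injective _ _

theorem var_ne_zero (i : Fin 4) : var i ≠ 0 :=
  (map_ne_zero_iff _ algebraMap_funField_injective).2 (MvPolynomial.X_ne_zero i)

/-- The substitution `y ↦ s^{k(e₊ + e₋)} Q(s^d/z) z^{deg Q} / x^k`, solving `F = 0` for `y`. -/
def solveY : MvPolynomial (Fin 4) ℂ →ₐ[ℂ] FunField :=
  MvPolynomial.aeval ![var 0, algebraMap _ FunField P.G / var 0 ^ P.k, var 2, var 3]

theorem solveY_x : P.solveY (X 0) = var 0 := by simp [solveY]

theorem solveY_y : P.solveY (X 1) = algebraMap _ FunField P.G / var 0 ^ P.k := by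
  simp only [solveY, MvPolynomial.aeval_X]; rfl

theorem solveY_z : P.solveY (X 2) = var 2 := by simp only [solveY, MvPolynomial.aeval_X]; rfl

theorem solveY_s : P.solveY (X 3) = var 3 := by simp only [solveY, MvPolynomial.aeval_X]; rfl

theorem solveY_C (c : ℂ) : P.solveY (C c) = algebraMap (MvPolynomial (Fin 4) ℂ) FunField (C c) := by
  rw [solveY, MvPolynomial.aeval_C, ← MvPolynomial.algebraMap_eq,
    ← IsScalarTower.algebraMap_apply]

theorem solveY_G : P.solveY P.G = algebraMap _ FunField P.G := by
  simp only [G, homQ, map_mul, map_pow, map_sum, solveY_s, solveY_z, solveY_C]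
  rfl

theorem solveY_F : P.solveY P.F = 0 := by
  rw [F_eq, map_sub, map_mul, map_pow, solveY_x, solveY_y, solveY_G,
    mul_div_cancel₀ _ (pow_ne_zero _ (var_ne_zero 0)), sub_self]

/-- Modulo `F` the product `x^k y` may be replaced by `G`, which does not involve `y`. Multiplying
by enough powers of `x` therefore eliminates `y`; the equation for `r` expresses that `y` is gone.
-/
theorem exists_pow_mul_sub_mem (p : MvPolynomial (Fin 4) ℂ) :
    ∃ (N : ℕ) (r : MvPolynomial (Fin 4) ℂ), X 0 ^ N * p - r ∈ Ideal.span {P.F} ∧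
      P.solveY r = algebraMap _ FunField r := by
  induction p using MvPolynomial.induction_on with
  | C c => exact ⟨0, C c, by simp, P.solveY_C c⟩
  | add p₁ p₂ h₁ h₂ =>
    obtain ⟨N₁, r₁, hm₁, hr₁⟩ := h₁
    obtain ⟨N₂, r₂, hm₂, hr₂⟩ := h₂
    refine ⟨N₁ + N₂, X 0 ^ N₂ * r₁ + X 0 ^ N₁ * r₂, ?_, ?_⟩
    · convert Ideal.add_mem _ (Ideal.mul_mem_left _ (X 0 ^ N₂) hm₁)
        (Ideal.mul_mem_left _ (X 0 ^ N₁) hm₂) using 1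
      ring
    · simp only [map_add, map_mul, map_pow, hr₁, hr₂, solveY_x]
      rfl
  | mul_X p i h =>
    obtain ⟨N, r, hm, hr⟩ := h
    by_cases hi : i = 1
    · subst hi
      refine ⟨N + P.k, r * P.G, ?_, by rw [map_mul, map_mul, hr, solveY_G]⟩
      convert Ideal.add_mem _ (Ideal.mul_mem_left _ (X 0 ^ P.k * X 1) hm)
        (Ideal.mul_mem_left _ r (Ideal.mem_span_singleton_self P.F)) using 1
      rw [F_eq]
      ring
    · refine ⟨N, r * X i, ?_, ?_⟩
      · convert Ideal.mul_mem_right (X i) _ hm using 1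
        ring
      · rw [map_mul, map_mul, hr]
        congr 1
        fin_cases i
        · exact P.solveY_x
        · exact absurd rfl hi
        · exact P.solveY_z
        · exact P.solveY_s

/-- The substitution `x = y = 0`, `z = t⁻¹`, `s = 1` kills `x` but sends `G` to `Q(t) t^{-deg Q}`,
which is nonzero. -/
theorem not_x_dvd_F : ¬(X 0 ∣ P.F) := by
  intro h
  have hG : X 0 ∣ P.G := by
    have := (dvd_mul_of_dvd_left (dvd_pow_self (X 0 : MvPolynomial (Fin 4) ℂ) P.k_pos.ne')
      (X 1)).sub h
    rwa [F_eq, sub_sub_cancel] at this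
  let g : MvPolynomial (Fin 4) ℂ →ₐ[ℂ] RatFunc ℂ := MvPolynomial.aeval ![0, 0, t⁻¹, 1]
  have g0 : g (X 0) = 0 := by simp only [g, MvPolynomial.aeval_X]; rfl
  have g2 : g (X 2) = t⁻¹ := by simp only [g, MvPolynomial.aeval_X]; rfl
  have g3 : g (X 3) = 1 := by simp only [g, MvPolynomial.aeval_X]; rfl
  have h1 := map_dvd g hG
  rw [g0, zero_dvd_iff, G, map_mul, map_pow, g3, one_pow, one_mul,
    P.map_homQ g t (by rw [g2, g3, mul_inv_cancel₀ t_ne_zero, one_pow]), g2, aeval_t] at h1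
  exact mul_ne_zero (pow_ne_zero _ (inv_ne_zero t_ne_zero)) P.q_ne_zero h1

/-- Eliminating `y` leaves `x^N p ≡ r` modulo `F`, and the substitution forces `r = 0`. So `F`
divides `x^N p`, and the prime `x`, which does not divide `F`, can be cancelled. -/
theorem mem_span_of_solveY_eq_zero {p : MvPolynomial (Fin 4) ℂ} (hp : P.solveY p = 0) :
    p ∈ Ideal.span {P.F} := by
  obtain ⟨N, r, hm, hr⟩ := P.exists_pow_mul_sub_mem p
  rw [Ideal.mem_span_singleton] at hm ⊢
  have h0 : r = 0 := by
    obtain ⟨v, hv⟩ := hm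
    have := congrArg P.solveY hv
    rw [map_sub, map_mul, hp, mul_zero, map_mul, solveY_F, zero_mul, zero_sub, neg_eq_zero,
      hr] at this
    exact (map_eq_zero_iff _ algebraMap_funField_injective).1 this
  rw [h0, sub_zero] at hm
  obtain ⟨v, hv⟩ := hm
  obtain ⟨v', rfl⟩ := MvPolynomial.X_prime.pow_dvd_of_dvd_mul_left N P.not_x_dvd_F ⟨p, hv.symm⟩
  refine ⟨v', mul_left_cancel₀ (pow_ne_zero N (MvPolynomial.X_ne_zero (R := ℂ) (0 : Fin 4))) ?_⟩
  rw [hv]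
  ring

/-- The rational function `s^d/z`. -/
def tau : FunField := var 3 ^ P.d / var 2

/-- Were `s^d / z` algebraic, it would be a constant `c`, and `s^d = c z` fails at `z = 0`, `s = 1`.
Transcendence is what allows `t ↦ s^d / z` to extend to all rational functions. -/
theorem transcendental_tau : Transcendental ℂ P.tau := by
  intro h
  obtain ⟨c, hc⟩ := mem_range_algebraMap_of_isAlgebraic h
  rw [tau, eq_div_iff (var_ne_zero 2), IsScalarTower.algebraMap_apply ℂ (MvPolynomial (Fin 4) ℂ),
    var, var, ← map_mul, ← map_pow] at hc
  have := congrArg (MvPolynomial.eval ![0, 0, 0, 1]) (algebraMap_funField_injective hc)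
  simp at this

theorem nonZeroDivisors_le_comap_aeval_tau : nonZeroDivisors ℂ[X] ≤
    (nonZeroDivisors FunField).comap (Polynomial.aeval (R := ℂ) P.tau) := by
  intro r hr
  rw [Submonoid.mem_comap, mem_nonZeroDivisors_iff_ne_zero]
  exact (map_ne_zero_iff _ (transcendental_iff_injective.1 P.transcendental_tau)).2
    (nonZeroDivisors.ne_zero hr)

/-- The homomorphism `t ↦ s^d/z`. -/
def liftT : RatFunc ℂ →ₐ[ℂ] FunField :=
  RatFunc.liftAlgHom (Polynomial.aeval P.tau) P.nonZeroDivisors_le_comap_aeval_tau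

theorem liftT_algebraMap (r : ℂ[X]) :
    P.liftT (algebraMap ℂ[X] (RatFunc ℂ) r) = Polynomial.aeval P.tau r := by
  have := RatFunc.liftAlgHom_apply_div' (Polynomial.aeval P.tau)
    P.nonZeroDivisors_le_comap_aeval_tau r 1
  rw [map_one, map_one, map_one, div_one, div_one] at this
  exact this

theorem liftT_t : P.liftT t = P.tau := by
  rw [t, ← RatFunc.algebraMap_X, liftT_algebraMap, Polynomial.aeval_X]

/-- The homomorphism `t ↦ s^d/z, u ↦ x/s^{e₊}`. -/
def rehom : (RatFunc ℂ)[T;T⁻¹] →+* FunField :=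
  LaurentPolynomial.eval₂ P.liftT.toRingHom
    (Units.mk0 (var 0 / var 3 ^ P.ePlus)
      (div_ne_zero (var_ne_zero 0) (pow_ne_zero _ (var_ne_zero 3))))

theorem rehom_C (f : RatFunc ℂ) : P.rehom (LaurentPolynomial.C f) = P.liftT f := by
  rw [rehom, LaurentPolynomial.eval₂_C]
  rfl

theorem rehom_T (n : ℤ) : P.rehom (LaurentPolynomial.T n) = (var 0 / var 3 ^ P.ePlus) ^ n := by
  rw [rehom, LaurentPolynomial.eval₂_T, Units.val_zpow_eq_zpow_val, Units.val_mk0]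

theorem rehom_dehom_X (i : Fin 4) :
    P.rehom (P.dehom (X i)) = P.solveY (X i) * (var 3)⁻¹ ^ P.weight i := by
  have h2 := var_ne_zero 2
  have h3 := var_ne_zero 3
  have h0 := var_ne_zero 0
  fin_cases i
  · change P.rehom (P.dehom (X 0)) = P.solveY (X 0) * (var 3)⁻¹ ^ (P.ePlus : ℤ)
    rw [dehom_x, rehom_T, solveY_x, zpow_one, zpow_natCast, inv_pow, div_eq_mul_inv]
  · change P.rehom (P.dehom (X 1)) = P.solveY (X 1) * (var 3)⁻¹ ^ P.weightY
    -- With `G = s^{k(e₊ + e₋)} z^{deg Q} Q(s^d / z)`, the claim for `y` becomes a comparison of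
    -- exponents of `s`, `z` and `x`.
    have hG : algebraMap _ FunField P.G = var 3 ^ P.exponent *
        (var 2 ^ P.Q.natDegree * Polynomial.aeval P.tau P.Q) := by
      rw [← solveY_G, G, map_mul, map_pow, P.map_homQ P.solveY P.tau, solveY_z, solveY_s]
      rw [solveY_z, solveY_s, tau, div_mul_cancel₀ _ h2]
    rw [dehom_y, map_mul, rehom_C, rehom_T, map_mul, q, liftT_algebraMap, map_pow, map_inv₀,
      liftT_t,
      solveY_y, hG]
    have hexp : (var 3) ^ P.exponent = var 3 ^ ((P.k : ℤ) * (P.ePlus + P.eMinus)) := by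
      rw [← exponent_cast, zpow_natCast]
    rw [hexp, weightY, inv_zpow, tau, inv_div, div_pow, zpow_neg, ← inv_zpow, inv_div, div_zpow,
      zpow_natCast, zpow_natCast, zpow_add₀ h3, mul_add, zpow_add₀ h3, zpow_mul _ _ (P.ePlus : ℤ),
      zpow_mul _ _ (P.Q.natDegree : ℤ)]
    simp only [zpow_natCast, ← pow_mul]
    have h4 : var 3 ^ ((P.k : ℤ) * P.eMinus) ≠ 0 := zpow_ne_zero _ h3
    field_simp
    ring
  · change P.rehom (P.dehom (X 2)) = P.solveY (X 2) * (var 3)⁻¹ ^ (P.d : ℤ)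
    rw [dehom_z, rehom_C, map_inv₀, liftT_t, solveY_z, zpow_natCast, tau, inv_div, inv_pow,
      div_eq_mul_inv]
  · change P.rehom (P.dehom (X 3)) = P.solveY (X 3) * (var 3)⁻¹ ^ (1 : ℤ)
    rw [dehom_s, map_one, solveY_s, zpow_one, mul_inv_cancel₀ h3]

/-- Each variable picks up the inverse power of `s` prescribed by its weight, and homogeneity
collects these into one factor. Hence setting `s = 1` can be undone on homogeneous polynomials, up
to solving for `y`. -/
theorem rehom_dehom {p : MvPolynomial (Fin 4) ℂ} {m : ℤ}
    (hp : p.IsWeightedHomogeneous P.weight m) :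
    P.rehom (P.dehom p) = P.solveY p * (var 3)⁻¹ ^ m := by
  have h1 : P.solveY p = MvPolynomial.aeval (fun i => P.solveY (X i)) p :=
    DFunLike.congr_fun (MvPolynomial.aeval_unique P.solveY) p
  rw [h1, ← aeval_mul_zpow hp _ (inv_ne_zero (var_ne_zero 3))]
  simp only [← rehom_dehom_X]
  have h2 : P.rehom.comp P.dehom.toRingHom =
      (MvPolynomial.aeval fun i => P.rehom (P.dehom (X i))).toRingHom := by
    refine MvPolynomial.ringHom_ext (fun c => ?_) fun i => ?_
    · change P.rehom (P.dehom (C c)) = MvPolynomial.aeval _ (C c)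
      rw [MvPolynomial.aeval_C, ← MvPolynomial.algebraMap_eq, AlgHom.commutes,
        LaurentPolynomial.algebraMap_apply, rehom_C, AlgHom.commutes]
    · exact (MvPolynomial.aeval_X (R := ℂ) (fun i => P.rehom (P.dehom (X i))) i).symm
  exact DFunLike.congr_fun h2 p

/-- The dehomogenization is injective, modulo `F`, on weighted homogeneous polynomials. -/
theorem mem_span_of_dehom_eq_zero {p : MvPolynomial (Fin 4) ℂ} {m : ℤ}
    (hp : p.IsWeightedHomogeneous P.weight m) (h : P.dehom p = 0) : p ∈ Ideal.span {P.F} := by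
  apply P.mem_span_of_solveY_eq_zero
  have := P.rehom_dehom hp
  rw [h, map_zero] at this
  exact (mul_eq_zero.1 this.symm).resolve_right
    (zpow_ne_zero _ (inv_ne_zero (var_ne_zero 3)))

/-! ### The divisors of the presentation -/

theorem ord_t_zero : ord 0 t = 1 := by
  rw [t, ← RatFunc.algebraMap_X, ord_algebraMap]
  have := Polynomial.rootMultiplicity_X_sub_C_self (x := (0 : ℂ))
  rw [Polynomial.C_0, sub_zero] at this
  exact_mod_cast this

theorem ord_t {c : ℂ} (hc : c ≠ 0) : ord c t = 0 := by
  rw [t, ← RatFunc.algebraMap_X, ord_algebraMap,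
    Polynomial.rootMultiplicity_eq_zero (by simpa using hc)]
  rfl

theorem ord_q (c : ℂ) : ord c P.q = P.Q.rootMultiplicity c := ord_algebraMap c P.Q

theorem ord_q_zero : ord 0 P.q = 0 := by
  rw [ord_q, Polynomial.rootMultiplicity_eq_zero P.eval_Q]
  rfl

theorem d_pos_rat : (0 : ℚ) < P.d := by exact_mod_cast P.d_pos

theorem k_pos_rat : (0 : ℚ) < P.k := by exact_mod_cast P.k_pos

theorem plus_zero : P.plus 0 = -((P.ePlus : ℚ) / P.d) := by rw [P.plus_eq]; simp

theorem plus_of_ne {c : ℂ} (hc : c ≠ 0) : P.plus c = 0 := by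
  rw [P.plus_eq, Finsupp.single_eq_of_ne hc]

theorem divisor_apply (Q : ℂ[X]) (c : ℂ) : divisor Q c = Q.rootMultiplicity c := by
  simp [divisor]

theorem minus_zero : P.minus 0 = -((P.eMinus : ℚ) / P.d) := by
  rw [P.minus_eq, Finsupp.sub_apply, Finsupp.smul_apply, divisor_apply,
    Polynomial.rootMultiplicity_eq_zero P.eval_Q]
  simp

theorem minus_of_ne {c : ℂ} (hc : c ≠ 0) :
    P.minus c = -((P.Q.rootMultiplicity c : ℚ) / P.k) := by
  rw [P.minus_eq, Finsupp.sub_apply, Finsupp.smul_apply, divisor_apply,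
    Finsupp.single_eq_of_ne hc, smul_eq_mul]
  ring

theorem bound_of_nonneg {i : ℤ} (hi : 0 ≤ i) (c : ℂ) : P.bound i c = i * P.plus c := if_pos hi

theorem bound_of_neg {i : ℤ} (hi : i < 0) (c : ℂ) : P.bound i c = -i * P.minus c :=
  if_neg (not_le.2 hi)

/-- The components of the algebra have poles at most at the origin. -/
theorem bound_nonpos {c : ℂ} (hc : c ≠ 0) (i : ℤ) : P.bound i c ≤ 0 := by
  rcases le_or_gt 0 i with hi | hi
  · rw [P.bound_of_nonneg hi, P.plus_of_ne hc, mul_zero]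
  · rw [P.bound_of_neg hi, P.minus_of_ne hc, neg_mul_neg]
    have : (i : ℚ) ≤ 0 := by exact_mod_cast hi.le
    exact mul_nonpos_of_nonpos_of_nonneg this (div_nonneg (by positivity) (by positivity))

/-! ### The dehomogenization takes values in the algebra -/

theorem weight_eq (e : Fin 4 →₀ ℕ) : Finsupp.weight P.weight e =
    e 0 * P.ePlus + e 1 * P.weightY + e 2 * P.d + e 3 := by
  rw [Finsupp.weight_apply, Finsupp.sum_fintype _ _ (by simp), Fin.sum_univ_four]
  simp [weight]

/-- At the origin the sum of order and bound is `(e 3 + k e 1 (e₊ + e₋)) / d` in nonnegative degrees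
and `(e 3 + e 0 (e₊ + e₋)) / d` in negative ones. Elsewhere, with `m` the multiplicity of the root
`c` of `Q`, it is `e 1 m`, respectively `e 0 m / k`. All four are nonnegative. -/
theorem allowed_monomial {e : Fin 4 →₀ ℕ} {n : ℕ}
    (he : Finsupp.weight P.weight e = n * P.d) (a : ℂ) :
    P.Allowed ((e 0 : ℤ) - P.k * e 1) (algebraMap ℂ (RatFunc ℂ) a * P.q ^ e 1 *
      t ^ ((n : ℤ) - (P.Q.natDegree * e 1 + e 2))) := by
  intro h c
  have h1 : algebraMap ℂ (RatFunc ℂ) a ≠ 0 := left_ne_zero_of_mul (left_ne_zero_of_mul h)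
  have hq := pow_ne_zero (e 1) P.q_ne_zero
  have ha : ord c (algebraMap ℂ (RatFunc ℂ) a) = 0 := by simp [ord]
  rw [ord_mul (mul_ne_zero h1 hq) (zpow_ne_zero _ t_ne_zero), ord_mul h1 hq, ha,
    ord_pow P.q_ne_zero, ord_zpow t_ne_zero, zero_add]
  have hE : (0 : ℚ) ≤ P.ePlus + P.eMinus := by exact_mod_cast P.eSum_nonneg
  have hd := P.d_pos_rat
  have hk := P.k_pos_rat
  have he0 : (0 : ℚ) ≤ e 0 := by positivity
  have he1 : (0 : ℚ) ≤ e 1 := by positivity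
  have he3 : (0 : ℚ) ≤ e 3 := by positivity
  by_cases hc : c = 0
  · subst hc
    rw [ord_q_zero, ord_t_zero]
    rw [weight_eq, weightY] at he
    -- The weight equation, solved for the exponent of `t`; the terms in `deg Q` cancel.
    have he' : ((n : ℚ) - (P.Q.natDegree * e 1 + e 2)) =
        (e 0 * P.ePlus + e 1 * P.k * P.eMinus + e 3) / P.d := by
      rw [eq_div_iff hd.ne']
      have : ((e 0 * P.ePlus + e 1 * (P.k * P.eMinus + P.d * P.Q.natDegree) + e 2 * P.d + e 3 : ℤ) :
        ℚ) = ((n * P.d : ℤ) : ℚ) := by rw [he]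
      push_cast at this
      linarith
    push_cast
    rw [mul_zero, zero_add, mul_one, he']
    rcases le_or_gt 0 ((e 0 : ℤ) - P.k * e 1) with hi | hi
    · rw [P.bound_of_nonneg hi, plus_zero]
      push_cast
      have : ((e 0 : ℚ) * P.ePlus + e 1 * P.k * P.eMinus + e 3) / P.d +
          (e 0 - P.k * e 1) * -(P.ePlus / P.d) =
          (e 3 + P.k * e 1 * (P.ePlus + P.eMinus)) / P.d := by
        field_simp
        ring
      rw [this]
      positivity
    · rw [P.bound_of_neg hi, minus_zero]
      push_cast
      have : ((e 0 : ℚ) * P.ePlus + e 1 * P.k * P.eMinus + e 3) / P.d +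
          -(e 0 - P.k * e 1) * -(P.eMinus / P.d) =
          (e 3 + e 0 * (P.ePlus + P.eMinus)) / P.d := by
        field_simp
        ring
      rw [this]
      positivity
  · rw [ord_t hc, ord_q]
    push_cast
    rw [mul_zero, add_zero]
    rcases le_or_gt 0 ((e 0 : ℤ) - P.k * e 1) with hi | hi
    · rw [P.bound_of_nonneg hi, P.plus_of_ne hc]
      positivity
    · rw [P.bound_of_neg hi, P.minus_of_ne hc]
      push_cast
      have : (e 1 : ℚ) * P.Q.rootMultiplicity c +
          -(e 0 - P.k * e 1) * -(P.Q.rootMultiplicity c / P.k) =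
          e 0 * (P.Q.rootMultiplicity c / P.k) := by
        field_simp
        ring
      rw [this]
      positivity

theorem dehom_mem {p : MvPolynomial (Fin 4) ℂ} {n : ℕ}
    (hp : p.IsWeightedHomogeneous P.weight (n * P.d)) :
    LaurentPolynomial.C (t ^ n) * P.dehom p ∈ P.algebra := by
  rw [p.as_sum, map_sum, Finset.mul_sum]
  refine sum_mem fun e he => ?_
  rw [dehom_monomial, LaurentPolynomial.single_eq_C_mul_T, ← mul_assoc, ← map_mul,
    ← LaurentPolynomial.single_eq_C_mul_T]
  convert P.single_mem_algebra (P.allowed_monomial (hp (MvPolynomial.mem_support_iff.1 he))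
    (p.coeff e)) using 2
  rw [sub_eq_add_neg, zpow_add₀ t_ne_zero, zpow_natCast]
  ring

/-- The dehomogenization on `ℂ[x, y, z, s] / (F)`. -/
def dehomQuot : QuotRing P.F →ₐ[ℂ] (RatFunc ℂ)[T;T⁻¹] :=
  Ideal.Quotient.liftₐ _ P.dehom fun a ha => by
    obtain ⟨b, rfl⟩ := Ideal.mem_span_singleton.1 ha
    rw [map_mul, dehom_F, zero_mul]

theorem isUnit_dehomQuot_z : IsUnit (P.dehomQuot.toRingHom P.z) := by
  refine IsUnit.of_mul_eq_one (LaurentPolynomial.C t) ?_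
  change P.dehom (X 2) * _ = 1
  rw [dehom_z, mul_comm, C_t_mul_C_inv]

/-- The dehomogenization on `(ℂ[x, y, z, s] / (F))[1/z]`. -/
def dehomLoc : Localization.Away P.z →+* (RatFunc ℂ)[T;T⁻¹] :=
  IsLocalization.Away.lift P.z P.isUnit_dehomQuot_z

theorem dehomLoc_algebraMap (r : QuotRing P.F) :
    P.dehomLoc (algebraMap _ _ r) = P.dehomQuot r :=
  IsLocalization.Away.lift_eq _ P.isUnit_dehomQuot_z r

theorem dehomLoc_mk (r : QuotRing P.F) (n : ℕ) (h) :
    P.dehomLoc (Localization.mk r ⟨P.z ^ n, h⟩) =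
      LaurentPolynomial.C (t ^ n) * P.dehomQuot r := by
  have h1 : Localization.mk r ⟨P.z ^ n, h⟩ * algebraMap _ (Localization.Away P.z) (P.z ^ n) =
      algebraMap _ (Localization.Away P.z) r := by
    rw [Localization.mk_eq_mk']
    exact IsLocalization.mk'_spec _ _ _
  have h2 := congrArg P.dehomLoc h1
  have hz : P.dehomQuot P.z = LaurentPolynomial.C t⁻¹ := P.dehom_z
  rw [map_mul, dehomLoc_algebraMap, dehomLoc_algebraMap, map_pow, hz] at h2
  rw [← h2, mul_left_comm, map_pow, ← mul_pow, C_t_mul_C_inv, one_pow, mul_one]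

/-! ### The degree zero part of `R[1/z]` -/

/-- The weights `w` with values in a monoid `M` are the weights of the presentation, for an
embedding of `M` into the integers. -/
structure IsWeight {M : Type} [AddCommMonoid M] (w : Fin 4 → M) (φ : M →+ ℤ) : Prop where
  injective : Function.Injective φ
  map_eq : ∀ i, φ (w i) = P.weight i

variable {P}

/-- Lets natural weights borrow the results proved for integral ones, so that both versions of the
chart share one argument. -/
theorem IsWeight.isWeightedHomogeneous_iff {M : Type} [AddCommMonoid M] {w : Fin 4 → M}
    {φ : M →+ ℤ} (hw : P.IsWeight w φ) {p : MvPolynomial (Fin 4) ℂ} {m : M} :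
    p.IsWeightedHomogeneous w m ↔ p.IsWeightedHomogeneous P.weight (φ m) := by
  refine forall_congr' fun e => imp_congr_right fun _ => ?_
  have h : φ (Finsupp.weight w e) = Finsupp.weight P.weight e := by
    rw [Finsupp.weight_apply, Finsupp.weight_apply, Finsupp.sum, Finsupp.sum, map_sum]
    simp only [map_nsmul, hw.map_eq]
  rw [← h, hw.injective.eq_iff]

theorem IsWeight.isWeightedHomogeneous_nsmul_iff {M : Type} [AddCommMonoid M] {w : Fin 4 → M}
    {φ : M →+ ℤ} (hw : P.IsWeight w φ) {p : MvPolynomial (Fin 4) ℂ} {n : ℕ} :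
    p.IsWeightedHomogeneous w (n • w 2) ↔ p.IsWeightedHomogeneous P.weight (n * P.d) := by
  rw [hw.isWeightedHomogeneous_iff, map_nsmul, hw.map_eq, nsmul_eq_mul]
  rfl

variable (P)

theorem z_mem {M : Type} [AddCommMonoid M] (w : Fin 4 → M) : P.z ∈ quotGrading w P.F (w 2) :=
  ⟨X 2, MvPolynomial.isWeightedHomogeneous_X ℂ w 2, rfl⟩

variable {M : Type} [AddCommMonoid M] [DecidableEq M] (w : Fin 4 → M)
  [GradedAlgebra (quotGrading w P.F)]

/-- The dehomogenization on the degree zero part of `(ℂ[x, y, z, s] / (F))[1/z]`. -/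
def chartHom : HomogeneousLocalization.Away (quotGrading w P.F) P.z →+* (RatFunc ℂ)[T;T⁻¹] :=
  P.dehomLoc.comp (algebraMap _ (Localization.Away P.z))

theorem chartHom_mk (n : ℕ) (p : MvPolynomial (Fin 4) ℂ)
    (hp : Ideal.Quotient.mk _ p ∈ quotGrading w P.F (n • w 2)) :
    P.chartHom w (HomogeneousLocalization.Away.mk _ (P.z_mem w) n (Ideal.Quotient.mk _ p) hp) =
      LaurentPolynomial.C (t ^ n) * P.dehom p :=
  P.dehomLoc_mk _ n _

theorem exists_eq_mk (b : HomogeneousLocalization.Away (quotGrading w P.F) P.z) :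
    ∃ (n : ℕ) (p : MvPolynomial (Fin 4) ℂ)
      (hp : Ideal.Quotient.mk _ p ∈ quotGrading w P.F (n • w 2)),
      p.IsWeightedHomogeneous w (n • w 2) ∧
      b = HomogeneousLocalization.Away.mk _ (P.z_mem w) n (Ideal.Quotient.mk _ p) hp := by
  obtain ⟨n, _, ⟨p, hp, rfl⟩, rfl⟩ := HomogeneousLocalization.Away.mk_surjective _ (P.z_mem w) b
  exact ⟨n, p, ⟨p, hp, rfl⟩, hp, rfl⟩

variable {P w} {φ : M →+ ℤ}

theorem IsWeight.chartHom_mem (hw : P.IsWeight w φ)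
    (b : HomogeneousLocalization.Away (quotGrading w P.F) P.z) : P.chartHom w b ∈ P.algebra := by
  obtain ⟨n, p, hp', hp, rfl⟩ := P.exists_eq_mk w b
  rw [chartHom_mk]
  exact P.dehom_mem (hw.isWeightedHomogeneous_nsmul_iff.1 hp)

theorem IsWeight.chartHom_injective (hw : P.IsWeight w φ) : Function.Injective (P.chartHom w) := by
  rw [injective_iff_map_eq_zero]
  intro b hb
  obtain ⟨n, p, hp', hp, rfl⟩ := P.exists_eq_mk w b
  rw [chartHom_mk] at hb
  -- The factor `tⁿ` is a unit of the Laurent ring and can be dropped.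
  have hd : P.dehom p = 0 := by
    have := congrArg (LaurentPolynomial.C (t⁻¹ ^ n) * ·) hb
    simpa only [← mul_assoc, ← map_mul, ← mul_pow, inv_mul_cancel₀ t_ne_zero, one_pow, map_one,
      one_mul, mul_zero] using this
  have h0 := P.mem_span_of_dehom_eq_zero (hw.isWeightedHomogeneous_iff.1 hp) hd
  apply HomogeneousLocalization.val_injective
  rw [HomogeneousLocalization.Away.val_mk, HomogeneousLocalization.val_zero]
  rw [Ideal.Quotient.eq_zero_iff_mem.2 h0, Localization.mk_zero]

theorem IsWeight.mem_range_chartHom (hw : P.IsWeight w φ) {p : MvPolynomial (Fin 4) ℂ} {n : ℕ}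
    (hp : p.IsWeightedHomogeneous P.weight (n * P.d)) :
    LaurentPolynomial.C (t ^ n) * P.dehom p ∈ (P.chartHom w).range :=
  ⟨_, P.chartHom_mk w n p ⟨p, hw.isWeightedHomogeneous_nsmul_iff.2 hp, rfl⟩⟩

theorem isWeightedHomogeneous_X_pow (i : Fin 4) (n : ℕ) :
    (X i ^ n : MvPolynomial (Fin 4) ℂ).IsWeightedHomogeneous P.weight (n * P.weight i) := by
  simpa using (MvPolynomial.isWeightedHomogeneous_X ℂ P.weight i).pow n

/-- The preimage is `s^d / z`. -/
theorem IsWeight.C_t_mem (hw : P.IsWeight w φ) :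
    LaurentPolynomial.C t ∈ (P.chartHom w).range := by
  have := hw.mem_range_chartHom (p := X 3 ^ P.d) (n := 1) (by
    convert isWeightedHomogeneous_X_pow 3 P.d using 1
    simp [weight])
  simpa [dehom_s] using this

theorem IsWeight.C_polynomial_mem (hw : P.IsWeight w φ) (r : ℂ[X]) :
    LaurentPolynomial.C (algebraMap ℂ[X] (RatFunc ℂ) r) ∈ (P.chartHom w).range := by
  rw [← aeval_C_t, Polynomial.aeval_eq_sum_range]
  refine sum_mem fun j _ => ?_
  rw [Algebra.smul_def]
  refine mul_mem ?_ (pow_mem hw.C_t_mem _)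
  have := hw.mem_range_chartHom (p := C (r.coeff j)) (n := 0) (by
    simpa using MvPolynomial.isWeightedHomogeneous_C P.weight (r.coeff j))
  rwa [pow_zero, map_one, one_mul, ← MvPolynomial.algebraMap_eq, AlgHom.commutes] at this

/-- The preimage is `x s^{d - e₊} / z`; this is where `e₊ ≤ d` is needed. -/
theorem IsWeight.t_mul_u_mem (hw : P.IsWeight w φ) :
    LaurentPolynomial.C t * LaurentPolynomial.T 1 ∈ (P.chartHom w).range := by
  have := hw.mem_range_chartHom (p := X 0 ^ 1 * X 3 ^ (P.d - P.ePlus)) (n := 1) (by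
    convert (isWeightedHomogeneous_X_pow 0 1).mul
      (isWeightedHomogeneous_X_pow 3 (P.d - P.ePlus)) using 1
    simp [weight, P.ePlus_le])
  simpa [dehom_s, dehom_x] using this

/-- The preimage is `x^d / z^{e₊}`. -/
theorem IsWeight.pow_x_mem (hw : P.IsWeight w φ) :
    LaurentPolynomial.C (t ^ P.ePlus) * LaurentPolynomial.T P.d ∈ (P.chartHom w).range := by
  have := hw.mem_range_chartHom (p := X 0 ^ P.d) (n := P.ePlus) (by
    convert isWeightedHomogeneous_X_pow 0 P.d using 1
    simp [weight, mul_comm])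
  simpa [dehom_x, LaurentPolynomial.T_pow] using this

/-- The preimage is `y^d / z^m` with `m` the weight of `y`. For negative `m` the power of `z`
belongs in the numerator, hence the truncations of both `m` and `-m`. -/
theorem IsWeight.pow_y_mem (hw : P.IsWeight w φ) :
    LaurentPolynomial.C (t ^ (P.k * P.eMinus) * P.q ^ P.d) *
      LaurentPolynomial.T (-(P.k * P.d : ℤ)) ∈ (P.chartHom w).range := by
  have hm : (P.weightY.toNat : ℤ) - (-P.weightY).toNat = P.weightY := by omega
  have := hw.mem_range_chartHom (p := X 1 ^ P.d * X 2 ^ (-P.weightY).toNat)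
    (n := P.weightY.toNat) (by
      convert (isWeightedHomogeneous_X_pow 1 P.d).mul
        (isWeightedHomogeneous_X_pow 2 (-P.weightY).toNat) using 1
      change _ = P.d * P.weightY + ((-P.weightY).toNat : ℤ) * P.d
      linear_combination (P.d : ℤ) * hm)
  convert this using 1
  rw [map_mul P.dehom, map_pow P.dehom, map_pow P.dehom, dehom_y, dehom_z, mul_pow,
    LaurentPolynomial.T_pow, ← map_pow, ← map_pow]
  rw [show -(P.k * P.d : ℤ) = P.d * -P.k by ring, mul_right_comm, ← mul_assoc, ← map_mul,
    ← map_mul]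
  congr 2
  have h : t ^ ((P.k : ℤ) * P.eMinus) = t ^ P.weightY.toNat * t⁻¹ ^ (-P.weightY).toNat *
      t⁻¹ ^ (P.Q.natDegree * P.d) := by
    rw [inv_pow, inv_pow, ← zpow_natCast, ← zpow_natCast, ← zpow_natCast, ← zpow_neg, ← zpow_neg,
      ← zpow_add₀ t_ne_zero, ← zpow_add₀ t_ne_zero, ← sub_eq_add_neg (P.weightY.toNat : ℤ), hm,
      weightY]
    push_cast
    congr 1
    ring
  rw [h, mul_pow, ← pow_mul]
  ring

/-! ### Integrality -/

theorem ord_nonneg_of_allowed {i : ℤ} {f : RatFunc ℂ} (h : P.Allowed i f) (hf : f ≠ 0) {c : ℂ}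
    (hc : c ≠ 0) : 0 ≤ ord c f := by
  have h1 := h hf c
  have h2 := P.bound_nonpos hc i
  have : (0 : ℚ) ≤ ord c f := by linarith
  exact_mod_cast this

/-- The power is `r(t) (t^{e₊} u^d)ⁿ` with `r = f^d t^{-n e₊}`. The condition at the origin reads `d
ord f ≥ n e₊`, so `r` has no poles and is a polynomial. -/
theorem IsWeight.pow_mem_of_nonneg (hw : P.IsWeight w φ) {n : ℕ} {f : RatFunc ℂ}
    (h : P.Allowed n f) (hf : f ≠ 0) :
    (LaurentPolynomial.C f * LaurentPolynomial.T (n : ℤ)) ^ P.d ∈ (P.chartHom w).range := by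
  have ht : t ^ (-((n * P.ePlus : ℕ) : ℤ)) ≠ 0 := zpow_ne_zero _ t_ne_zero
  have hfd := pow_ne_zero P.d hf
  obtain ⟨r, hr⟩ := exists_polynomial_of_ord_nonneg
    (f := f ^ P.d * t ^ (-((n * P.ePlus : ℕ) : ℤ))) (by
      intro c
      rw [ord_mul hfd ht, ord_pow hf, ord_zpow t_ne_zero]
      by_cases hc : c = 0
      · subst hc
        have h1 := h hf 0
        rw [P.bound_of_nonneg (by positivity), plus_zero] at h1
        have h2 := mul_nonneg h1 P.d_pos_rat.le
        rw [add_mul, mul_assoc, neg_mul, div_mul_cancel₀ _ P.d_pos_rat.ne'] at h2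
        have h3 : (0 : ℚ) ≤ ((P.d * ord 0 f - n * P.ePlus : ℤ) : ℚ) := by
          push_cast
          push_cast at h2
          linarith
        have h4 : 0 ≤ P.d * ord 0 f - n * P.ePlus := by exact_mod_cast h3
        rw [ord_t_zero]
        push_cast
        linarith
      · rw [ord_t hc, mul_zero, add_zero]
        exact mul_nonneg (by positivity) (ord_nonneg_of_allowed h hf hc))
  have hfr : f ^ P.d = algebraMap ℂ[X] (RatFunc ℂ) r * t ^ (n * P.ePlus) := by
    rw [← hr, mul_assoc, zpow_neg, zpow_natCast, inv_mul_cancel₀ (pow_ne_zero _ t_ne_zero), mul_one]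
  have := mul_mem (hw.C_polynomial_mem r) (pow_mem hw.pow_x_mem n)
  convert this using 1
  rw [mul_pow, ← map_pow, hfr, mul_pow, LaurentPolynomial.T_pow, LaurentPolynomial.T_pow, map_mul,
    ← map_pow, ← pow_mul, mul_comm P.ePlus, mul_comm (P.d : ℤ), mul_assoc]

/-- The power is `r(t) (t^{k e₋} Q^d u^{-kd})ⁿ`. The exponent `k d` clears the denominator `d` of
`D₋` at the origin and its denominator `k` along the roots of `Q`, which makes `r` a polynomial. -/
theorem IsWeight.pow_mem_of_neg (hw : P.IsWeight w φ) {n : ℕ} (hn : 0 < n) {f : RatFunc ℂ}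
    (h : P.Allowed (-n) f) (hf : f ≠ 0) :
    (LaurentPolynomial.C f * LaurentPolynomial.T (-n : ℤ)) ^ (P.k * P.d) ∈
      (P.chartHom w).range := by
  have ht : t ^ (-(n * P.k * P.eMinus)) ≠ 0 := zpow_ne_zero _ t_ne_zero
  have hq : P.q ^ (-((P.d * n : ℕ) : ℤ)) ≠ 0 := zpow_ne_zero _ P.q_ne_zero
  have hfd := pow_ne_zero (P.k * P.d) hf
  obtain ⟨r, hr⟩ := exists_polynomial_of_ord_nonneg
    (f := f ^ (P.k * P.d) * t ^ (-(n * P.k * P.eMinus)) * P.q ^ (-((P.d * n : ℕ) : ℤ))) (by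
      intro c
      rw [ord_mul (mul_ne_zero hfd ht) hq, ord_mul hfd ht, ord_pow hf, ord_zpow t_ne_zero,
        ord_zpow P.q_ne_zero]
      have h1 := h hf c
      rw [P.bound_of_neg (by omega)] at h1
      by_cases hc : c = 0
      · subst hc
        rw [minus_zero] at h1
        have h2 := mul_nonneg h1 P.d_pos_rat.le
        rw [add_mul, mul_assoc, neg_mul (_ / _), div_mul_cancel₀ _ P.d_pos_rat.ne'] at h2
        have h3 : (0 : ℚ) ≤ ((P.d * ord 0 f - n * P.eMinus : ℤ) : ℚ) := by
          push_cast
          push_cast at h2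
          linarith
        have h4 : 0 ≤ P.d * ord 0 f - n * P.eMinus := by exact_mod_cast h3
        have h5 := mul_nonneg (Int.natCast_nonneg P.k) h4
        rw [ord_t_zero, ord_q_zero]
        push_cast
        linarith
      · rw [P.minus_of_ne hc] at h1
        have h2 := mul_nonneg h1 P.k_pos_rat.le
        rw [add_mul, mul_assoc, neg_mul (_ / _), div_mul_cancel₀ _ P.k_pos_rat.ne'] at h2
        have h3 : (0 : ℚ) ≤ ((P.k * ord c f - n * P.Q.rootMultiplicity c : ℤ) : ℚ) := by
          push_cast
          push_cast at h2
          linarith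
        have h4 : 0 ≤ P.k * ord c f - n * P.Q.rootMultiplicity c := by exact_mod_cast h3
        have h5 := mul_nonneg (Int.natCast_nonneg P.d) h4
        rw [ord_t hc, ord_q]
        push_cast
        linarith)
  have hfr : f ^ (P.k * P.d) =
      algebraMap ℂ[X] (RatFunc ℂ) r * (t ^ (n * P.k * P.eMinus) * P.q ^ (P.d * n)) := by
    rw [← hr, zpow_neg, zpow_neg, zpow_natCast]
    have h1 := zpow_ne_zero (n * P.k * P.eMinus) t_ne_zero
    have h2 := pow_ne_zero (P.d * n) P.q_ne_zero
    field_simp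
  have := mul_mem (hw.C_polynomial_mem r) (pow_mem hw.pow_y_mem n)
  convert this using 1
  rw [mul_pow, ← map_pow, hfr, mul_pow, LaurentPolynomial.T_pow, LaurentPolynomial.T_pow, ← map_pow,
    ← mul_assoc (LaurentPolynomial.C _), ← map_mul, mul_pow, ← pow_mul, ← zpow_natCast (t ^ _),
    ← zpow_mul]
  rw [show ((P.k * P.d : ℕ) : ℤ) * -n = n * -(P.k * P.d) by push_cast; ring,
    show (n : ℤ) * P.k * P.eMinus = P.k * P.eMinus * n by ring]

/-- The homomorphism from the degree zero part of `R[1/z]` to the algebra of the surface. -/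
def IsWeight.toAlgebra (hw : P.IsWeight w φ) :
    HomogeneousLocalization.Away (quotGrading w P.F) P.z →+* P.algebra :=
  (P.chartHom w).codRestrict P.algebra hw.chartHom_mem

theorem IsWeight.toAlgebra_injective (hw : P.IsWeight w φ) : Function.Injective hw.toAlgebra :=
  fun _ _ h => hw.chartHom_injective (congrArg Subtype.val h)

theorem IsWeight.exists_toAlgebra_eq (hw : P.IsWeight w φ) {a : P.algebra}
    (ha : (a : (RatFunc ℂ)[T;T⁻¹]) ∈ (P.chartHom w).range) : ∃ b, hw.toAlgebra b = a := by
  obtain ⟨b, hb⟩ := ha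
  exact ⟨b, Subtype.ext hb⟩

theorem IsWeight.isIntegralElem_single (hw : P.IsWeight w φ) {i : ℤ} {f : RatFunc ℂ}
    (h : P.Allowed i f) :
    hw.toAlgebra.IsIntegralElem ⟨AddMonoidAlgebra.single i f, P.single_mem_algebra h⟩ := by
  let := hw.toAlgebra.toAlgebra
  have key : ∀ N : ℕ, 0 < N →
      (AddMonoidAlgebra.single i f : (RatFunc ℂ)[T;T⁻¹]) ^ N ∈ (P.chartHom w).range →
      hw.toAlgebra.IsIntegralElem ⟨AddMonoidAlgebra.single i f, P.single_mem_algebra h⟩ := by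
    intro N hN hmem
    obtain ⟨b, hb⟩ := hw.exists_toAlgebra_eq
      (a := ⟨AddMonoidAlgebra.single i f, P.single_mem_algebra h⟩ ^ N) hmem
    refine IsIntegral.of_pow hN ?_
    rw [← hb]
    exact isIntegral_algebraMap
  by_cases hf : f = 0
  · refine key 1 one_pos ?_
    rw [hf, AddMonoidAlgebra.single_zero, pow_one]
    exact zero_mem _
  obtain ⟨n, rfl | rfl⟩ := Int.eq_nat_or_neg i
  · refine key _ P.d_pos ?_
    rw [LaurentPolynomial.single_eq_C_mul_T]
    exact hw.pow_mem_of_nonneg h hf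
  -- Degree `-0` falls under the convention for `D₊`, so it is sent back to the nonnegative case.
  · rcases Nat.eq_zero_or_pos n with rfl | hn
    · refine key _ P.d_pos ?_
      rw [LaurentPolynomial.single_eq_C_mul_T]
      exact hw.pow_mem_of_nonneg (n := 0) (by simpa using h) hf
    · refine key _ (Nat.mul_pos P.k_pos P.d_pos) ?_
      rw [LaurentPolynomial.single_eq_C_mul_T]
      exact hw.pow_mem_of_neg hn h hf

theorem sum_single_coeff {R : Type*} [Semiring R] (p : R[T;T⁻¹]) :
    p = ∑ i ∈ p.coeff.support, AddMonoidAlgebra.single i (p.coeff i) := by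
  classical
  refine LaurentPolynomial.ext fun j => ?_
  rw [AddMonoidAlgebra.coeff_sum, Finsupp.finsetSum_apply]
  simp only [AddMonoidAlgebra.coeff_single, Finsupp.single_apply, Finset.sum_ite_eq']
  split_ifs with h
  · rfl
  · exact Finsupp.notMem_support_iff.1 h

theorem IsWeight.toAlgebra_isIntegral (hw : P.IsWeight w φ) : hw.toAlgebra.IsIntegral := by
  intro a
  let := hw.toAlgebra.toAlgebra
  have ha : a = ∑ i ∈ a.1.coeff.support,
      (⟨AddMonoidAlgebra.single i (a.1.coeff i), P.single_mem_algebra (a.2 i)⟩ : P.algebra) := by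
    refine Subtype.ext ?_
    rw [AddSubmonoidClass.coe_finsetSum]
    exact sum_single_coeff a.1
  rw [ha]
  exact IsIntegral.sum _ fun i _ => hw.isIntegralElem_single (a.2 i)

/-! ### Birationality -/

/-- Rewrite `(t² u)ⁿ f uⁱ` as `f t^{n - i}` times `(t u)^{n + i}`. For large `n` the first factor is
a polynomial, since `f` has poles at most at the origin, and `n + i` is nonnegative. -/
theorem IsWeight.eventually_mem (hw : P.IsWeight w φ) {i : ℤ} {f : RatFunc ℂ}
    (h : P.Allowed i f) : ∀ᶠ n : ℕ in Filter.atTop,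
      (LaurentPolynomial.C (t ^ 2) * LaurentPolynomial.T 1) ^ n * AddMonoidAlgebra.single i f ∈
        (P.chartHom w).range := by
  by_cases hf : f = 0
  · simp [hf, zero_mem]
  filter_upwards [Filter.eventually_ge_atTop i.natAbs,
    Filter.eventually_ge_atTop (i - ord 0 f).natAbs] with n hn hn'
  obtain ⟨r, hr⟩ := exists_polynomial_of_ord_nonneg (f := f * t ^ ((n : ℤ) - i)) (by
    intro c
    rw [ord_mul hf (zpow_ne_zero _ t_ne_zero), ord_zpow t_ne_zero]
    by_cases hc : c = 0
    · subst hc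
      rw [ord_t_zero]
      omega
    · rw [ord_t hc, mul_zero, add_zero]
      exact ord_nonneg_of_allowed h hf hc)
  obtain ⟨m, hm⟩ : ∃ m : ℕ, (n : ℤ) + i = m := ⟨((n : ℤ) + i).toNat, by omega⟩
  convert mul_mem (hw.C_polynomial_mem r) (pow_mem hw.t_mul_u_mem m) using 1
  rw [← hr, mul_pow, mul_pow, LaurentPolynomial.T_pow, LaurentPolynomial.T_pow,
    LaurentPolynomial.single_eq_C_mul_T, ← map_pow, ← map_pow, mul_one, mul_one, ← hm,
    LaurentPolynomial.T_add, ← mul_assoc, ← mul_assoc, ← mul_assoc,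
    mul_right_comm _ _ (LaurentPolynomial.C f),
    ← map_mul, ← map_mul, ← zpow_natCast t m, ← hm, mul_assoc f, ← zpow_add₀ t_ne_zero]
  congr 3
  rw [← pow_mul, ← zpow_natCast, mul_comm]
  congr 2
  push_cast
  ring

theorem IsWeight.isNormalization (hw : P.IsWeight w φ) :
    IsNormalization (Spec.map (CommRingCat.ofHom hw.toAlgebra)) := by
  -- The element to be inverted is `t² u = t · (t u)`, the product of two elements already known to
  -- be in the image.
  have hmem : LaurentPolynomial.C (t ^ 2) * LaurentPolynomial.T 1 ∈ (P.chartHom w).range := by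
    have := mul_mem hw.C_t_mem hw.t_mul_u_mem
    rwa [← mul_assoc, ← map_mul, ← sq] at this
  obtain ⟨h, hh⟩ := hmem
  have hh' : (hw.toAlgebra h : (RatFunc ℂ)[T;T⁻¹]) =
      LaurentPolynomial.C (t ^ 2) * LaurentPolynomial.T 1 := hh
  refine isNormalization_specMap hw.toAlgebra hw.toAlgebra_injective hw.toAlgebra_isIntegral h ?_ ?_
  · intro h0
    have h1 := congrArg Subtype.val h0
    rw [hh', ← LaurentPolynomial.single_eq_C_mul_T] at h1
    exact pow_ne_zero 2 t_ne_zero (AddMonoidAlgebra.single_eq_zero.1 h1)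
  · intro a
    -- There are finitely many homogeneous components, so one exponent serves them all.
    obtain ⟨n, hn⟩ := ((Filter.eventually_all_finset a.1.coeff.support).2
      fun i _ => hw.eventually_mem (a.2 i)).exists
    have h1 : (hw.toAlgebra h ^ n * a : P.algebra).1 ∈ (P.chartHom w).range := by
      change (hw.toAlgebra h).1 ^ n * a.1 ∈ _
      rw [hh', sum_single_coeff a.1, Finset.mul_sum]
      exact sum_mem hn
    obtain ⟨b, hb⟩ := hw.exists_toAlgebra_eq h1
    exact ⟨b, n, hb⟩

end Presentation

/-! ### Compatibility with the torus action and with the structure over `ℂ` -/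

theorem DivisorPair.laurentScale_C_mul_T (a : ℂˣ) (f : RatFunc ℂ) (n : ℤ) :
    DivisorPair.laurentScale a (LaurentPolynomial.C f * LaurentPolynomial.T n) =
      LaurentPolynomial.C (algebraMap ℂ (RatFunc ℂ) ((a ^ n : ℂˣ) : ℂ)) *
        (LaurentPolynomial.C f * LaurentPolynomial.T n) := by
  refine LaurentPolynomial.ext fun i => ?_
  rw [DivisorPair.coeff_laurentScale, ← mul_assoc, ← map_mul,
    ← LaurentPolynomial.single_eq_C_mul_T, ← LaurentPolynomial.single_eq_C_mul_T,
    AddMonoidAlgebra.coeff_single, AddMonoidAlgebra.coeff_single, Finsupp.single_apply,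
    Finsupp.single_apply]
  split_ifs with h
  · rw [h]
  · rw [mul_zero]

theorem DivisorPair.laurentScale_C (a : ℂˣ) (f : RatFunc ℂ) :
    DivisorPair.laurentScale a (LaurentPolynomial.C f) = LaurentPolynomial.C f := by
  simpa using DivisorPair.laurentScale_C_mul_T a f 0

/-- An endomorphism of a graded ring fixing `s` acts on the chart `{s ≠ 0}` of `Proj`. -/
theorem awayι_comp_projMap {A : Type} [CommRing A] [Algebra ℂ A] {𝒜 : ℕ → Submodule ℂ A}
    [GradedAlgebra 𝒜] (f : 𝒜 →+*ᵍ 𝒜) (hf) {i : ℕ} (hi : 0 < i) (s s' : A) (hs : s ∈ 𝒜 i)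
    (hs' : s' ∈ 𝒜 i) (h : f s = s')
    (hle : Submonoid.powers s ≤ (Submonoid.powers s').comap f) :
    Proj.awayι 𝒜 s' hs' hi ≫ Proj.map f hf =
      Spec.map (CommRingCat.ofHom (HomogeneousLocalization.map f hle)) ≫ Proj.awayι 𝒜 s hs hi := by
  subst h
  exact Proj.awayι_comp_map f hf hi s hs

namespace Presentation

open MvPolynomial (X C)

variable (P : Presentation)

/-- The images of `x, y, z, s` have `u`-degrees `1, -k, 0, 0`, which are the exponents of `a` in the
rescaling; it is enough to compare on constants and variables. -/
theorem dehom_polyScale (a : ℂˣ) (p : MvPolynomial (Fin 4) ℂ) :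
    P.dehom (polyScale (P.torus a) p) = DivisorPair.laurentScale a (P.dehom p) := by
  have hC : ∀ c : ℂ, P.dehom (C c) = LaurentPolynomial.C (algebraMap ℂ (RatFunc ℂ) c) := fun c => by
    rw [← MvPolynomial.algebraMap_eq, AlgHom.commutes, LaurentPolynomial.algebraMap_apply]
  have hX : ∀ i, polyScale (P.torus a) (X i) = C (P.torus a i) * X i := fun i => by simp [polyScale]
  have h : P.dehom.toRingHom.comp (polyScale (P.torus a)).toRingHom =
      (DivisorPair.laurentScale a).comp P.dehom.toRingHom := by
    refine MvPolynomial.ringHom_ext (fun c => ?_) fun i => ?_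
    · change P.dehom (polyScale _ (C c)) = DivisorPair.laurentScale a (P.dehom (C c))
      rw [polyScale, MvPolynomial.aeval_C, MvPolynomial.algebraMap_eq, hC,
        DivisorPair.laurentScale_C]
    · change P.dehom (polyScale _ (X i)) = DivisorPair.laurentScale a (P.dehom (X i))
      rw [hX, map_mul, hC]
      fin_cases i
      · change LaurentPolynomial.C (algebraMap ℂ (RatFunc ℂ) (a : ℂ)) * P.dehom (X 0) =
          DivisorPair.laurentScale a (P.dehom (X 0))
        have := DivisorPair.laurentScale_C_mul_T a 1 1
        rw [map_one, one_mul, zpow_one] at this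
        rw [dehom_x, this]
      · change LaurentPolynomial.C (algebraMap ℂ (RatFunc ℂ) (((a ^ P.k)⁻¹ : ℂˣ) : ℂ)) *
          P.dehom (X 1) = DivisorPair.laurentScale a (P.dehom (X 1))
        rw [dehom_y, DivisorPair.laurentScale_C_mul_T, zpow_neg, zpow_natCast]
      · change LaurentPolynomial.C (algebraMap ℂ (RatFunc ℂ) 1) * P.dehom (X 2) =
          DivisorPair.laurentScale a (P.dehom (X 2))
        rw [dehom_z, DivisorPair.laurentScale_C, map_one, map_one, one_mul]
      · change LaurentPolynomial.C (algebraMap ℂ (RatFunc ℂ) 1) * P.dehom (X 3) =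
          DivisorPair.laurentScale a (P.dehom (X 3))
        rw [dehom_s, map_one, map_one, map_one, one_mul]
  exact DFunLike.congr_fun h p

theorem powers_z_le {M : Type} [AddCommMonoid M] [DecidableEq M] (w : Fin 4 → M) (a : ℂˣ) :
    Submonoid.powers P.z ≤ (Submonoid.powers P.z).comap (P.gradedAct w a) :=
  Submonoid.powers_le.2 ⟨1, (pow_one _).trans (P.gradedAct_z w a).symm⟩

variable {P} {M : Type} [AddCommMonoid M] [DecidableEq M] {w : Fin 4 → M}
  [GradedAlgebra (quotGrading w P.F)] {φ : M →+ ℤ}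

/-- The torus fixes `z`, so it acts on a fraction `p / zⁿ` through the numerator, and the factor
`tⁿ` has `u`-degree zero. -/
theorem IsWeight.act_comp_toAlgebra (hw : P.IsWeight w φ) (a : ℂˣ) :
    (P.toDivisorPair.act a).comp hw.toAlgebra =
      hw.toAlgebra.comp (HomogeneousLocalization.map (P.gradedAct w a) (P.powers_z_le w a)) := by
  refine RingHom.ext fun b => Subtype.ext ?_
  change DivisorPair.laurentScale a (P.chartHom w b) = P.chartHom w
    (HomogeneousLocalization.map (P.gradedAct w a) (P.powers_z_le w a) b)
  obtain ⟨n, p, hp', hp, rfl⟩ := P.exists_eq_mk w b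
  have hz : (P.gradedAct w a) (P.z ^ n) = P.z ^ n := by rw [map_pow, gradedAct_z]
  have hp'' : Ideal.Quotient.mk _ (polyScale (P.torus a) p) ∈ quotGrading w P.F (n • w 2) :=
    (P.gradedAct w a).map_mem hp'
  have hmap : HomogeneousLocalization.map (P.gradedAct w a) (P.powers_z_le w a)
      (HomogeneousLocalization.Away.mk _ (P.z_mem w) n (Ideal.Quotient.mk _ p) hp') =
      HomogeneousLocalization.Away.mk _ (P.z_mem w) n
        (Ideal.Quotient.mk _ (polyScale (P.torus a) p)) hp'' := by
    apply HomogeneousLocalization.val_injective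
    change Localization.mk _ (⟨(P.gradedAct w a) (P.z ^ n), _⟩ : Submonoid.powers P.z) =
      Localization.mk _ (⟨P.z ^ n, _⟩ : Submonoid.powers P.z)
    congr 1
    exact Subtype.ext hz
  rw [hmap, chartHom_mk, chartHom_mk, map_mul, DivisorPair.laurentScale_C, dehom_polyScale]

theorem IsWeight.toAlgebra_comp_algebraMap (hw : P.IsWeight w φ) :
    hw.toAlgebra.comp ((HomogeneousLocalization.fromZeroRingHom (quotGrading w P.F)
      (Submonoid.powers P.z)).comp (algebraMap ℂ (quotGrading w P.F 0))) =
      algebraMap ℂ P.algebra := by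
  refine RingHom.ext fun c => Subtype.ext ?_
  change P.dehomLoc (algebraMap (QuotRing P.F) (Localization.Away P.z)
    (algebraMap ℂ (QuotRing P.F) c)) = algebraMap ℂ (RatFunc ℂ)[T;T⁻¹] c
  rw [dehomLoc_algebraMap, AlgHom.commutes]

variable (P)

theorem isWeight_weight : P.IsWeight P.weight (AddMonoidHom.id ℤ) :=
  ⟨fun _ _ h => h, fun _ => rfl⟩

theorem isWeight_natWeight (h : 0 < P.weightY) :
    P.IsWeight P.natWeight (Nat.castAddMonoidHom ℤ) := by
  refine ⟨Nat.cast_injective, fun i => ?_⟩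
  fin_cases i
  · rfl
  · exact Int.toNat_of_nonneg h.le
  · rfl
  · rfl

theorem isEquivariantNormalization_chart : IsEquivariantNormalization P.surface P.chart := by
  refine ⟨Spec.map (CommRingCat.ofHom P.isWeight_weight.toAlgebra),
    P.isWeight_weight.isNormalization, ?_, fun a => ?_⟩
  · change Spec.map _ ≫ Spec.map _ = Spec.map _
    rw [← Spec.map_comp, ← CommRingCat.ofHom_comp]
    exact congrArg (fun r => Spec.map (CommRingCat.ofHom r))
      P.isWeight_weight.toAlgebra_comp_algebraMap
  · change Spec.map _ ≫ Spec.map _ = Spec.map _ ≫ Spec.map _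
    rw [← Spec.map_comp, ← Spec.map_comp, ← CommRingCat.ofHom_comp, ← CommRingCat.ofHom_comp]
    exact congrArg (fun r => Spec.map (CommRingCat.ofHom r))
      (P.isWeight_weight.act_comp_toAlgebra a)

/-! ### The principal open subset of `Proj` for a positive weight of `y` -/

theorem natWeight_z_pos : 0 < P.natWeight 2 := P.d_pos

section Projective

variable [hY : Fact (0 < P.weightY)]

/-- The isomorphism of `Spec (R[1/z])₀` with the principal open subset `D₊(z)`. -/
def openIso : Spec (CommRingCat.of
    (HomogeneousLocalization.Away (quotGrading P.natWeight P.F) P.z)) ≅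
      (P.principalOpen : Scheme.{0}) :=
  (Proj.basicOpenIsoSpec (quotGrading P.natWeight P.F) P.z (P.z_mem P.natWeight)
    P.natWeight_z_pos).symm

theorem openIso_hom_ι : P.openIso.hom ≫ P.principalOpen.ι =
    Proj.awayι (quotGrading P.natWeight P.F) P.z (P.z_mem P.natWeight) P.natWeight_z_pos :=
  rfl

theorem openIso_hom_str : P.openIso.hom ≫ P.principalOpen.ι ≫ P.hypersurfaceStr =
    Spec.map (CommRingCat.ofHom ((HomogeneousLocalization.fromZeroRingHom
      (quotGrading P.natWeight P.F) (Submonoid.powers P.z)).comp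
        (algebraMap ℂ (quotGrading P.natWeight P.F 0)))) := by
  rw [← Category.assoc, openIso_hom_ι]
  exact (Proj.awayι_toSpecZero_assoc _ _ _ _ _).trans (Spec.map_comp _ _).symm

/-- Both sides are compared after the open immersion into `Proj`, where functoriality of the affine
charts applies because `z` is fixed. -/
theorem openIso_hom_act (a : ℂˣ) :
    P.openIso.hom ≫
        (P.hypersurfaceAct a).resLE P.principalOpen P.principalOpen (P.principalOpen_le a) =
      Spec.map (CommRingCat.ofHom (HomogeneousLocalization.map (P.gradedAct P.natWeight a)
        (P.powers_z_le P.natWeight a))) ≫ P.openIso.hom := by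
  rw [← cancel_mono P.principalOpen.ι, Category.assoc, Category.assoc, Scheme.Hom.resLE_comp_ι,
    openIso_hom_ι, ← Category.assoc, openIso_hom_ι]
  exact awayι_comp_projMap (P.gradedAct P.natWeight a) (P.irrelevant_le_map_act a)
    P.natWeight_z_pos P.z P.z (P.z_mem P.natWeight) (P.z_mem P.natWeight)
    (P.gradedAct_z P.natWeight a) _

theorem isEquivariantNormalization_openPart :
    IsEquivariantNormalization P.surface P.openPart := by
  have hw := P.isWeight_natWeight hY.out
  refine ⟨Spec.map (CommRingCat.ofHom hw.toAlgebra) ≫ P.openIso.hom,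
    hw.isNormalization.comp_iso P.openIso, ?_, fun a => ?_⟩
  · change (Spec.map (CommRingCat.ofHom hw.toAlgebra) ≫ P.openIso.hom) ≫
      P.principalOpen.ι ≫ P.hypersurfaceStr =
        Spec.map (CommRingCat.ofHom (algebraMap ℂ P.algebra))
    rw [Category.assoc, openIso_hom_str, ← Spec.map_comp, ← CommRingCat.ofHom_comp,
      hw.toAlgebra_comp_algebraMap]
  · change Spec.map (CommRingCat.ofHom (P.toDivisorPair.act a)) ≫
      Spec.map (CommRingCat.ofHom hw.toAlgebra) ≫ P.openIso.hom =
      (Spec.map (CommRingCat.ofHom hw.toAlgebra) ≫ P.openIso.hom) ≫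
        (P.hypersurfaceAct a).resLE P.principalOpen P.principalOpen (P.principalOpen_le a)
    rw [Category.assoc, openIso_hom_act, ← Category.assoc, ← Category.assoc, ← Spec.map_comp,
      ← Spec.map_comp, ← CommRingCat.ofHom_comp, ← CommRingCat.ofHom_comp, hw.act_comp_toAlgebra]

end Projective

end Presentation

end CStarSurface

end

theorem theorem2p3 (P : CStarSurface.Presentation) :
    0 ≤ (P.ePlus : ℤ) + P.eMinus ∧
    P.F.IsWeightedHomogeneous P.weight
      ((P.k : ℤ) * (P.ePlus + P.eMinus) + P.d * P.Q.natDegree) ∧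
    CStarSurface.IsEquivariantNormalization P.surface P.chart ∧
    ∀ _ : Fact (0 < P.weightY),
      CStarSurface.IsEquivariantNormalization P.surface P.openPart := by
  refine ⟨P.eSum_nonneg, ?_, P.isEquivariantNormalization_chart,
    fun _ => P.isEquivariantNormalization_openPart⟩
  convert P.F_isWeightedHomogeneous using 1
  -- The exponent of `s` is a truncated natural number; it equals `k(e₊ + e₋)` because `e₊ + e₋` is
  -- nonnegative.
  rw [nsmul_eq_mul, nsmul_eq_mul, P.exponent_cast]
  change _ = _ * 1 + _ * (P.d : ℤ)
  ring
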